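/- Let $P:\mathbb C\to\mathbb C$ be a polynomial of degree $d\ge 2$, let $K_P$ be its filled Julia set (the set of points with bounded forward orbit), and let $G(z)=\lim_{n\to\infty} d^{-n}\log_+|P^{\circ n}(z)|$, where $\log_+ s=\max\{0,\log s\}$, be its Green function. Let $C$ be a connected component of $K_P$ with $P(C)=C$, and assume that $C$ is not a repelling fixed point, i.e. $C$ is not of the form $\{z\}$ with $P(z)=z$ and $|P'(z)|>1$. Then there are numbers $s,s'>0$, a connected component $D$ of $\{z: G(z)<s\}$ and a connected component $D'$ of $\{z: G(z)<s'\}$ such that $(P;D,D')$ is a polynomial-like map, that is: * $D$ and $D'$ are bounded simply connected domains with $C^\infty$ boundary and $\overline D\subset D'$; * for some $m\ge 2$, $P:\overline D\to\overline{D'}$ is an $m$-fold branched covering which is holomorphic in $D$; and such that the filled Julia set of $(P;D,D')$ is exactly $C$: $$\{z:\ P^{\circ n}(z)\in\overline D\ \text{ for all } n\ge 0\}=C .$$ Here an $m$-fold branched covering $\overline D\to\overline{D'}$ is a continuous surjection for which there is a finite set $B$ in the interior of $\overline{D'}$, whose preimage in $\overline D$ is a finite subset of the interior of $\overline D$, such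 that the map is an $m$-sheeted covering over $\overline{D'}\smallsetminus B$. -/

import Mathlib

open Polynomial Filter Topology Set
open scoped Real ContDiff

/-- The filled Julia set `K_P`: the points with bounded forward orbit under `P`. -/
def filledJuliaSet (P : ℂ[X]) : Set ℂ :=
  {z | Bornology.IsBounded (Set.range fun n : ℕ => (fun w => P.eval w)^[n] z)}

/-- The Green function of `K_P`, i.e. `G(z) = lim log⁺ |Pⁿ(z)| / dⁿ` with `d = deg P`.
The limit exists when `d ≥ 2`, see `tendsto_greenFunction`. -/
noncomputable def greenFunction (P : ℂ[X]) (z : ℂ) : ℝ :=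
  limUnder atTop fun n : ℕ =>
    Real.posLog ‖(fun w => P.eval w)^[n] z‖ / (P.natDegree : ℝ) ^ n

/-- `C` is a connected component of the set `S` (in the subspace topology). -/
def IsComponentOf {X : Type*} [TopologicalSpace X] (C S : Set X) : Prop :=
  ∃ x ∈ S, C = connectedComponentIn S x

/-- The open set `D ⊆ ℂ` has smooth boundary: near each of its boundary points it is
`{ρ < 0}` for a smooth real function `ρ` with nonzero differential. -/
def HasSmoothBoundary (D : Set ℂ) : Prop :=
  ∀ p ∈ frontier D, ∃ (U : Set ℂ) (ρ : ℂ → ℝ), IsOpen U ∧ p ∈ U ∧ ContDiffOn ℝ ∞ ρ U ∧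
    (∀ z ∈ U, fderiv ℝ ρ z ≠ 0) ∧ D ∩ U = {z ∈ U | ρ z < 0}

/-- A bounded simply connected domain in the plane with smooth boundary. -/
structure IsSmoothDisc (D : Set ℂ) : Prop where
  isOpen : IsOpen D
  isBounded : Bornology.IsBounded D
  isSimplyConnected : IsSimplyConnected D
  hasSmoothBoundary : HasSmoothBoundary D

/-- `f : S → T` is a branched covering with `m` sheets, for `S, T ⊆ ℂ`: it is continuous and onto,
and there is a finite set `B` of (branch) values in the interior of `T`, with a finite preimage
in the interior of `S`, such that `f` is an `m`-sheeted covering over `T ∖ B`.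
(Where `f` is moreover holomorphic and nonconstant near the points over `B`, it is of the
form `z ↦ z ^ k` there in suitable local coordinates.) -/
def IsBranchedCovering (f : ℂ → ℂ) (S T : Set ℂ) (m : ℕ) : Prop :=
  ContinuousOn f S ∧ SurjOn f S T ∧ ∃ h : MapsTo f S T, ∃ B : Set ℂ,
    B.Finite ∧ B ⊆ interior T ∧ (S ∩ f ⁻¹' B).Finite ∧ S ∩ f ⁻¹' B ⊆ interior S ∧
    IsCoveringMapOn (h.restrict f S T) {w : T | (w : ℂ) ∉ B} ∧
    ∀ w ∈ T \ B, (S ∩ f ⁻¹' {w}).ncard = m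

/-- `(f ; D, D')` is a polynomial-like map of degree `m`.
Only the values of `f` on `closure D` matter. -/
structure IsPolynomialLike (f : ℂ → ℂ) (D D' : Set ℂ) (m : ℕ) : Prop where
  isSmoothDisc_source : IsSmoothDisc D
  isSmoothDisc_target : IsSmoothDisc D'
  closure_subset : closure D ⊆ D'
  two_le : 2 ≤ m
  differentiableOn : DifferentiableOn ℂ f D
  isBranchedCovering : IsBranchedCovering f (closure D) (closure D') m

/-- The filled Julia set `⋂ₙ f⁻ⁿ(closure D)` of the polynomial-like map `(f ; D, D')`, where `f` is
regarded as a map defined on `closure D` only: the points whose orbit never leaves `closure D`. -/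
def polynomialLikeFilledJuliaSet (f : ℂ → ℂ) (D : Set ℂ) : Set ℂ :=
  {z | ∀ n : ℕ, f^[n] z ∈ closure D}

theorem tendsto_eval_div_pow (P : ℂ[X]) :
    Tendsto (fun z : ℂ => P.eval z / z ^ P.natDegree) (cocompact ℂ) (𝓝 P.leadingCoeff) := by
  have h1 : Tendsto (fun z : ℂ => P.reverse.eval z⁻¹) (cocompact ℂ) (𝓝 (P.reverse.eval 0)) :=
    (P.reverse.continuous.tendsto 0).comp (by
      rw [← Metric.cobounded_eq_cocompact]; exact tendsto_inv₀_cobounded)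
  rw [← coeff_zero_eq_eval_zero, coeff_zero_reverse] at h1
  refine h1.congr' ?_
  have h0 : ∀ᶠ z : ℂ in cocompact ℂ, z ≠ 0 := by
    have := (isCompact_singleton (x := (0 : ℂ))).compl_mem_cocompact
    filter_upwards [this] with z hz using by simpa using hz
  filter_upwards [h0] with z hz
  let _ : Invertible z := invertibleOfNonzero hz
  have h2 := eval₂_reverse_mul_pow (RingHom.id ℂ) z P
  rw [eq_div_iff (pow_ne_zero _ hz)]
  simpa using h2

theorem exists_bound_posLog_eval (P : ℂ[X]) (hP : 2 ≤ P.natDegree) :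
    ∃ M : ℝ, ∀ z : ℂ, |Real.posLog ‖P.eval z‖ - P.natDegree * Real.posLog ‖z‖| ≤ M := by
  have hP0 : P ≠ 0 := by rintro rfl; simp at hP
  have hlc : P.leadingCoeff ≠ 0 := leadingCoeff_ne_zero.mpr hP0
  set h : ℂ → ℝ := fun z => Real.posLog ‖P.eval z‖ - P.natDegree * Real.posLog ‖z‖ with hh
  have hcont : Continuous h := by
    have := P.continuous
    have := Real.continuous_posLog
    fun_prop
  have hlim : Tendsto (fun z : ℂ => Real.log ‖P.eval z / z ^ P.natDegree‖) (cocompact ℂ)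
      (𝓝 (Real.log ‖P.leadingCoeff‖)) :=
    ((tendsto_eval_div_pow P).norm).log (norm_ne_zero_iff.mpr hlc)
  have hz1 : ∀ᶠ z : ℂ in cocompact ℂ, 1 ≤ ‖z‖ :=
    (tendsto_norm_cocompact_atTop (E := ℂ)).eventually_ge_atTop 1
  have hP1 : ∀ᶠ z : ℂ in cocompact ℂ, 1 ≤ ‖P.eval z‖ := by
    have : Tendsto (fun z : ℂ => ‖P.eval z‖) (cocompact ℂ) atTop :=
      P.tendsto_norm_atTop (natDegree_pos_iff_degree_pos.mp (by omega))
        (tendsto_norm_cocompact_atTop (E := ℂ))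
    exact this.eventually_ge_atTop 1
  have hlim' : Tendsto h (cocompact ℂ) (𝓝 (Real.log ‖P.leadingCoeff‖)) := by
    refine hlim.congr' ?_
    filter_upwards [hz1, hP1] with z h1 h2
    have e1 : ‖z‖ ≠ 0 := by positivity
    have e2 : ‖P.eval z‖ ≠ 0 := by positivity
    rw [hh]
    simp only
    rw [Real.posLog_eq_log (by simpa using h2), Real.posLog_eq_log (by simpa using h1), norm_div,
      norm_pow, Real.log_div e2 (pow_ne_zero _ e1), Real.log_pow]
  set c := Real.log ‖P.leadingCoeff‖
  have hev : ∀ᶠ z in cocompact ℂ, |h z - c| < 1 := by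
    have := hlim'.eventually (Metric.ball_mem_nhds c one_pos)
    simpa [Real.dist_eq] using this
  obtain ⟨K, hK, hKs⟩ := mem_cocompact.mp hev
  obtain ⟨M, hM⟩ := hK.exists_bound_of_continuousOn hcont.continuousOn
  refine ⟨max M (|c| + 1), fun z => ?_⟩
  by_cases hz : z ∈ K
  · exact le_max_of_le_left (by simpa using hM z hz)
  · refine le_max_of_le_right ?_
    have h3 : |h z - c| < 1 := hKs hz
    have h4 : |h z| ≤ |h z - c| + |c| := by simpa using abs_add_le (h z - c) c
    change |h z| ≤ _
    linarith

/-- The limit that defines the Green function exists. -/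
theorem tendsto_greenFunction (P : ℂ[X]) (hP : 2 ≤ P.natDegree) (z : ℂ) :
    Tendsto (fun n : ℕ => Real.posLog ‖(fun w => P.eval w)^[n] z‖ / (P.natDegree : ℝ) ^ n)
      atTop (𝓝 (greenFunction P z)) := by
  obtain ⟨M, hM⟩ := exists_bound_posLog_eval P hP
  have hd : (2 : ℝ) ≤ P.natDegree := by exact_mod_cast hP
  have hd0 : (0 : ℝ) < P.natDegree := by linarith
  refine CauchySeq.tendsto_limUnder (cauchySeq_of_le_geometric ((P.natDegree : ℝ)⁻¹)
    (M / P.natDegree) (inv_lt_one_of_one_lt₀ (by linarith)) fun n => ?_)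
  rw [dist_comm, Real.dist_eq, Function.iterate_succ_apply']
  set w := (fun w => P.eval w)^[n] z
  have e : Real.posLog ‖P.eval w‖ / (P.natDegree : ℝ) ^ (n + 1)
      - Real.posLog ‖w‖ / (P.natDegree : ℝ) ^ n
      = (Real.posLog ‖P.eval w‖ - P.natDegree * Real.posLog ‖w‖) / (P.natDegree : ℝ) ^ (n + 1) := by
    field_simp
    ring
  rw [e, abs_div, abs_of_pos (pow_pos hd0 (n + 1))]
  calc _ ≤ M / (P.natDegree : ℝ) ^ (n + 1) := by gcongr; exact hM w
    _ = _ := by rw [inv_pow]; field_simp; ring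

/-! Fix a point `c` of `C` and a level `s₀` such that no `s₀ / d ^ k` is a critical value of `G` or
a value of `G` at a critical value of `P`; only countably many levels are lost. Put `s k = s₀ / d ^
k` and let `D k` be the component of `{G < s k}` that contains `c`. Since `G ∘ P = d * G`, `P` maps
`closure (D (k + 1))` onto `closure (D k)` as a branched covering, of some degree `m k`
(`exists_isBranchedCovering`). The closures of the `D k` decrease to a continuum on which `G = 0`,
that is, to `C`.

Counting preimages of a generic point shows that `m` is antitone, so it is constant from some `N`
on. Then `D (N + 1)` contains no preimage of `D k`, `k ≥ N`, outside `D (k + 1)`: it would raise the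
number of preimages. Hence an orbit that stays in `D (N + 1)` lies in every `D k`, so in `C`, and `D
(N + 1)`, `D N` are the domains sought.

It remains to exclude `m N = 1`. In that case the inverse branch of `P` is a holomorphic map of `D
N` into its relatively compact subset `D (N + 1)`, and it maps `C` onto itself. The Earle–Hamilton
contraction argument (`eq_singleton_of_image_eq`) makes `C` an attracting fixed point of the branch,
which is a repelling fixed point of `P`.

The `D k` are smooth discs: off the filled Julia set `G` is locally the real part of a holomorphic
function, so regular levels bound smooth domains, and the maximum principle forbids holes. That a
bounded domain without holes is simply connected (`isSimplyConnected_of_no_holes`) is proved by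
hand. Loops define a cocycle with values in the fundamental group; on a fine square grid its
holonomy can be pushed out to the exterior, so it has a potential near any given loop, and the
potential contracts that loop. -/

/-! ### Nonabelian cochains on the square grid -/

/-- Two squares of the integer grid share an edge. -/
def GridAdj (p q : ℤ × ℤ) : Prop :=
  (p.2 = q.2 ∧ (q.1 = p.1 + 1 ∨ p.1 = q.1 + 1)) ∨ (p.1 = q.1 ∧ (q.2 = p.2 + 1 ∨ p.2 = q.2 + 1))

/-- The cochain with values `h` on horizontal and `v` on vertical edges has trivial holonomy
around the square with lower left corner `q`. -/
def GridFlat {Γ : Type*} [Group Γ] (h v : ℤ → ℤ → Γ) (q : ℤ × ℤ) : Prop :=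
  h q.1 q.2 * v (q.1 + 1) q.2 = v q.1 q.2 * h q.1 (q.2 + 1)

/-- Two cochains agree on the edges of the square `q`. -/
def GridAgree {Γ : Type*} (h v h' v' : ℤ → ℤ → Γ) (q : ℤ × ℤ) : Prop :=
  h' q.1 q.2 = h q.1 q.2 ∧ h' q.1 (q.2 + 1) = h q.1 (q.2 + 1) ∧
    v' q.1 q.2 = v q.1 q.2 ∧ v' (q.1 + 1) q.2 = v (q.1 + 1) q.2

/-- `φ` is a potential of the cochain along the edges of the square `q`. -/
def GridPotential {Γ : Type*} [Group Γ] (h v φ : ℤ → ℤ → Γ) (q : ℤ × ℤ) : Prop :=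
  φ (q.1 + 1) q.2 = φ q.1 q.2 * h q.1 q.2 ∧
    φ (q.1 + 1) (q.2 + 1) = φ q.1 (q.2 + 1) * h q.1 (q.2 + 1) ∧
    φ q.1 (q.2 + 1) = φ q.1 q.2 * v q.1 q.2 ∧
    φ (q.1 + 1) (q.2 + 1) = φ (q.1 + 1) q.2 * v (q.1 + 1) q.2

theorem GridAgree.trans {Γ : Type*} {h v h' v' h'' v'' : ℤ → ℤ → Γ} {q : ℤ × ℤ} (H : GridAgree h v h' v' q)
    (H' : GridAgree h' v' h'' v'' q) : GridAgree h v h'' v'' q :=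
  ⟨H'.1.trans H.1, H'.2.1.trans H.2.1, H'.2.2.1.trans H.2.2.1, H'.2.2.2.trans H.2.2.2⟩

section Grid

variable {Γ : Type*} [Group Γ]

theorem exists_int_primitive (h : ℤ → Γ) : ∃ f : ℤ → Γ, ∀ i, f (i + 1) = f i * h i := by
  let a : ℕ → Γ := fun n => Nat.rec 1 (fun k x => x * h k) n
  let b : ℕ → Γ := fun n => Nat.rec 1 (fun k x => x * (h (-(k + 1 : ℤ)))⁻¹) n
  refine ⟨fun i => if 0 ≤ i then a i.toNat else b (-i).toNat, fun i => ?_⟩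
  rcases lt_trichotomy i (-1) with hi | hi | hi
  · obtain ⟨k, rfl⟩ : ∃ k : ℕ, i = -((k + 1 : ℤ) + 1) := ⟨(-i - 2).toNat, by omega⟩
    have e1 : (-(-((k + 1 : ℤ) + 1) + 1)).toNat = k + 1 := by omega
    have e2 : (-(-((k + 1 : ℤ) + 1))).toNat = k + 2 := by omega
    simp only [e1, e2]
    rw [if_neg (by omega), if_neg (by omega)]
    simp [b]
  · subst hi
    simp [a, b]
  · obtain ⟨k, rfl⟩ : ∃ k : ℕ, i = k := ⟨i.toNat, by omega⟩
    have e1 : ((k : ℤ) + 1).toNat = k + 1 := by omega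
    simp only [e1]
    rw [if_pos (by omega), if_pos (by omega)]
    simp [a]

theorem GridAgree.gridFlat {h v h' v' : ℤ → ℤ → Γ} {q : ℤ × ℤ} (H : GridAgree h v h' v' q)
    (hq : GridFlat h v q) : GridFlat h' v' q := by
  obtain ⟨h1, h2, h3, h4⟩ := H
  unfold GridFlat at *
  rw [h1, h2, h3, h4, hq]

/-- The holonomy around `q` can be pushed to an adjacent square. -/
theorem exists_gridFlat_of_adj (h v : ℤ → ℤ → Γ) (S : Set (ℤ × ℤ)) {q q' : ℤ × ℤ} (hq : q ∉ S)
    (hq' : q' ∉ S) (hadj : GridAdj q q') :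
    ∃ h' v' : ℤ → ℤ → Γ, (∀ p ∈ S, GridAgree h v h' v' p) ∧ GridFlat h' v' q := by
  obtain ⟨a, b⟩ := q
  obtain ⟨a', b'⟩ := q'
  have key : ∀ p ∈ S, p ≠ (a, b) ∧ p ≠ (a', b') := fun p hp =>
    ⟨fun e => hq (e ▸ hp), fun e => hq' (e ▸ hp)⟩
  -- In each of the four positions only the edge common to `q` and `q'` is redefined, by solving the
  -- flatness equation of `q` for it; no square of `S` has this edge.
  rcases hadj with ⟨h1, h2 | h2⟩ | ⟨h1, h2 | h2⟩ <;> simp only at h1 h2 <;> subst h1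
  · subst h2
    refine ⟨h, fun i j => if i = a + 1 ∧ j = b then (h a b)⁻¹ * (v a b * h a (b + 1)) else v i j,
      fun p hp => ?_, ?_⟩
    · have := key p hp
      simp only [ne_eq, Prod.ext_iff] at this
      refine ⟨rfl, rfl, if_neg ?_, if_neg ?_⟩ <;> omega
    · simp [GridFlat]
  · refine ⟨h, fun i j => if i = a ∧ j = b then h a b * v (a + 1) b * (h a (b + 1))⁻¹ else v i j,
      fun p hp => ?_, ?_⟩
    · have := key p hp
      simp only [ne_eq, Prod.ext_iff] at this
      refine ⟨rfl, rfl, if_neg ?_, if_neg ?_⟩ <;> omega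
    · simp [GridFlat]
  · subst h2
    refine ⟨fun i j => if i = a ∧ j = b + 1 then (v a b)⁻¹ * (h a b * v (a + 1) b) else h i j, v,
      fun p hp => ?_, ?_⟩
    · have := key p hp
      simp only [ne_eq, Prod.ext_iff] at this
      refine ⟨if_neg ?_, if_neg ?_, rfl, rfl⟩ <;> omega
    · simp [GridFlat]
  · refine ⟨fun i j => if i = a ∧ j = b then v a b * h a (b + 1) * (v (a + 1) b)⁻¹ else h i j, v,
      fun p hp => ?_, ?_⟩
    · have := key p hp
      simp only [ne_eq, Prod.ext_iff] at this
      refine ⟨if_neg ?_, if_neg ?_, rfl, rfl⟩ <;> omega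
    · simp [GridFlat]

/-- A cochain that is flat on a finite set `S` of squares can be made flat on a whole box, without
changing it on the edges of `S`, if all squares off `S` are connected to the exterior off `S`. -/
theorem exists_gridFlat_box (B : Finset (ℤ × ℤ)) (ρ : ℤ × ℤ → ℕ) (n : ℕ) :
    ∀ (h v : ℤ → ℤ → Γ) (S : Set (ℤ × ℤ)), {q ∈ (B : Set (ℤ × ℤ)) | q ∉ S}.ncard = n →
    (∀ q ∈ S, GridFlat h v q) →
    (∀ q ∈ B, q ∉ S → ∃ q', q' ∉ S ∧ GridAdj q q' ∧ ρ q' < ρ q) →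
    ∃ h' v' : ℤ → ℤ → Γ, (∀ q ∈ S, GridAgree h v h' v' q) ∧ ∀ q ∈ B, GridFlat h' v' q := by
  induction n with
  | zero =>
    intro h v S hn hS _
    refine ⟨h, v, fun q _ => ⟨rfl, rfl, rfl, rfl⟩, fun q hq => hS q ?_⟩
    rw [Set.ncard_eq_zero (B.finite_toSet.subset (sep_subset _ _))] at hn
    by_contra hqS
    exact (hn ▸ (⟨hq, hqS⟩ : q ∈ {q ∈ (B : Set (ℤ × ℤ)) | q ∉ S}) : q ∈ (∅ : Set (ℤ × ℤ)))
  | succ n ih =>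
    intro h v S hn hS hρ
    have hfin : {q ∈ (B : Set (ℤ × ℤ)) | q ∉ S}.Finite := B.finite_toSet.subset (sep_subset _ _)
    have hne : {q ∈ (B : Set (ℤ × ℤ)) | q ∉ S}.Nonempty :=
      Set.nonempty_of_ncard_ne_zero (by omega)
    -- A square of maximal rank is repaired first: no remaining square can need it as its neighbour
    -- of smaller rank, so the hypothesis on `ρ` survives its insertion into `S`.
    obtain ⟨q, ⟨hqB, hqS⟩, hmax⟩ := Set.exists_max_image _ ρ hfin hne
    obtain ⟨q', hq'S, hadj, _⟩ := hρ q hqB hqS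
    obtain ⟨h1, v1, hagree, hflat⟩ := exists_gridFlat_of_adj h v S hqS hq'S hadj
    have hset : {p ∈ (B : Set (ℤ × ℤ)) | p ∉ insert q S}
        = {p ∈ (B : Set (ℤ × ℤ)) | p ∉ S} \ {q} := by
      ext p
      simp only [mem_ofPred_eq, mem_insert_iff, Set.mem_sdiff, mem_singleton_iff]
      tauto
    obtain ⟨h2, v2, hagree2, hflat2⟩ := ih h1 v1 (insert q S)
      (by rw [hset, Set.ncard_sdiff_singleton_of_mem (show q ∈ {p ∈ (B : Set (ℤ × ℤ)) | p ∉ S} from ⟨hqB, hqS⟩),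
        hn]; rfl)
      (by
        rintro p (rfl | hp)
        · exact hflat
        · exact (hagree p hp).gridFlat (hS p hp))
      (by
        intro p hpB hpS
        rw [mem_insert_iff, not_or] at hpS
        obtain ⟨p', hp'S, hpadj, hlt⟩ := hρ p hpB hpS.2
        refine ⟨p', ?_, hpadj, hlt⟩
        rw [mem_insert_iff, not_or]
        refine ⟨?_, hp'S⟩
        rintro rfl
        exact absurd (hmax p ⟨hpB, hpS.2⟩) (not_le.mpr hlt))
    exact ⟨h2, v2, fun p hp => (hagree p hp).trans (hagree2 p (mem_insert_of_mem _ hp)), hflat2⟩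

/-- A cochain that is flat on a box has a potential there. -/
theorem exists_gridPotential_of_flat (h v : ℤ → ℤ → Γ) (a b : ℤ)
    (hflat : ∀ q ∈ Finset.Ico a b ×ˢ Finset.Ico a b, GridFlat h v q) :
    ∃ φ : ℤ → ℤ → Γ, ∀ q ∈ Finset.Ico a b ×ˢ Finset.Ico a b, GridPotential h v φ q := by
  obtain ⟨A, hA⟩ := exists_int_primitive fun i => h i a
  choose V hV using fun i : ℤ => exists_int_primitive fun j => v i j
  -- Integrate along the bottom row, then up each column; the factor `(V i a)⁻¹` gives `φ i a = A
  -- i`. Vertical edges hold by construction, horizontal ones by induction on the height through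
  -- flatness.
  set φ : ℤ → ℤ → Γ := fun i j => A i * (V i a)⁻¹ * V i j with hφ
  have hver : ∀ i j, φ i (j + 1) = φ i j * v i j := fun i j => by
    simp only [hφ, hV, mul_assoc]
  have hbase : ∀ i, φ (i + 1) a = φ i a * h i a := fun i => by simp [hφ, hA]
  clear_value φ
  have hhor : ∀ i ∈ Finset.Ico a b, ∀ j, a ≤ j → j ≤ b → φ (i + 1) j = φ i j * h i j := by
    intro i hi j haj
    induction j, haj using Int.leInduction with
    | base => exact fun _ => hbase i
    | succ j haj ih =>
      intro hjb
      have hf := hflat (i, j) (by simp only [Finset.mem_product, Finset.mem_Ico] at *; omega)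
      unfold GridFlat at hf
      rw [hver, hver, ih (by omega), mul_assoc, mul_assoc]
      exact congrArg (φ i j * ·) hf
  refine ⟨φ, fun q hq => ?_⟩
  simp only [Finset.mem_product, Finset.mem_Ico] at hq
  have hi : q.1 ∈ Finset.Ico a b := by simp only [Finset.mem_Ico]; omega
  exact ⟨hhor _ hi _ (by omega) (by omega), hhor _ hi _ (by omega) (by omega), hver _ _, hver _ _⟩

/-- The flat extension to the box has a potential, and the extension agrees with the given cochain
on the edges of `S`. -/
theorem exists_gridPotential (h v : ℤ → ℤ → Γ) (a b : ℤ) (S : Set (ℤ × ℤ))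
    (hS : S ⊆ (Finset.Ico a b ×ˢ Finset.Ico a b : Finset (ℤ × ℤ)))
    (hflat : ∀ q ∈ S, GridFlat h v q) (ρ : ℤ × ℤ → ℕ)
    (hρ : ∀ q ∈ Finset.Ico a b ×ˢ Finset.Ico a b, q ∉ S →
      ∃ q', q' ∉ S ∧ GridAdj q q' ∧ ρ q' < ρ q) :
    ∃ φ : ℤ → ℤ → Γ, ∀ q ∈ S, GridPotential h v φ q := by
  obtain ⟨h', v', hag, hfl⟩ := exists_gridFlat_box _ ρ _ h v S rfl hflat hρ
  obtain ⟨φ, hφ⟩ := exists_gridPotential_of_flat h' v' a b hfl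
  refine ⟨φ, fun q hq => ?_⟩
  obtain ⟨e1, e2, e3, e4⟩ := hag q hq
  have := hφ q (hS hq)
  unfold GridPotential at this ⊢
  rwa [e1, e2, e3, e4] at this

end Grid

/-! ### Grid squares and plane domains without holes -/

/-- The closed unit square with lower left corner `q`. -/
def gridSquare (q : ℤ × ℤ) : Set ℂ := Icc (q.1 : ℝ) (q.1 + 1) ×ℂ Icc (q.2 : ℝ) (q.2 + 1)

/-- The grid point with the given integer coordinates. -/
def gridVertex (i j : ℤ) : ℂ := ⟨i, j⟩

/-- The lower left corner of a unit square that contains `z`. -/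
noncomputable def gridFloor (z : ℂ) : ℤ × ℤ := (⌊z.re⌋, ⌊z.im⌋)

theorem mem_gridSquare {q : ℤ × ℤ} {z : ℂ} : z ∈ gridSquare q ↔
    ((q.1 : ℝ) ≤ z.re ∧ z.re ≤ q.1 + 1) ∧ ((q.2 : ℝ) ≤ z.im ∧ z.im ≤ q.2 + 1) := by
  simp [gridSquare, Complex.mem_reProdIm]

theorem mem_gridSquare_gridFloor (z : ℂ) : z ∈ gridSquare (gridFloor z) :=
  mem_gridSquare.2 ⟨⟨Int.floor_le _, (Int.lt_floor_add_one _).le⟩,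
    ⟨Int.floor_le _, (Int.lt_floor_add_one _).le⟩⟩

theorem convex_gridSquare (q : ℤ × ℤ) : Convex ℝ (gridSquare q) :=
  ((convex_Icc _ _).linear_preimage Complex.reLm).inter
    ((convex_Icc _ _).linear_preimage Complex.imLm)

theorem isCompact_gridSquare (q : ℤ × ℤ) : IsCompact (gridSquare q) :=
  isCompact_Icc.reProdIm isCompact_Icc

theorem eventually_floor_le (t : ℝ) : ∀ᶠ u : ℝ in 𝓝 t, (⌊u⌋ : ℝ) ≤ t ∧ t ≤ ⌊u⌋ + 1 := by
  have h1 : ∀ᶠ u : ℝ in 𝓝 t, (⌈t⌉ - 1 : ℝ) < u := lt_mem_nhds (by linarith [Int.ceil_lt_add_one t])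
  have h2 : ∀ᶠ u : ℝ in 𝓝 t, u < ⌊t⌋ + 1 := gt_mem_nhds (Int.lt_floor_add_one t)
  filter_upwards [h1, h2] with u hu1 hu2
  have h3 : ⌈t⌉ - 1 ≤ ⌊u⌋ := Int.le_floor.2 (by push_cast; linarith)
  have h4 : ⌊u⌋ < ⌊t⌋ + 1 := Int.floor_lt.2 (by push_cast; linarith)
  have h3' : (⌈t⌉ : ℝ) - 1 ≤ ⌊u⌋ := by exact_mod_cast h3
  have h4' : (⌊u⌋ : ℝ) ≤ ⌊t⌋ := by exact_mod_cast Int.lt_add_one_iff.1 h4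
  exact ⟨h4'.trans (Int.floor_le t), by linarith [Int.le_ceil t]⟩

theorem eventually_mem_gridSquare (x : ℂ) : ∀ᶠ y in 𝓝 x, x ∈ gridSquare (gridFloor y) := by
  filter_upwards [(Complex.continuous_re.tendsto x).eventually (eventually_floor_le x.re),
    (Complex.continuous_im.tendsto x).eventually (eventually_floor_le x.im)] with y h1 h2
  exact mem_gridSquare.2 ⟨h1, h2⟩

/-- Two squares through `x` differ by at most one in each coordinate. The intermediate square
`(q'.1, q.2)` also contains `x`, so it is off `S`, and two adjacency steps suffice even for a
diagonal pair. -/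
theorem gridAdj_closed_of_mem {U S : Set (ℤ × ℤ)}
    (hU : ∀ q ∈ U, ∀ q', q' ∉ S → GridAdj q q' → q' ∈ U) {x : ℂ}
    (hx : ∀ q, x ∈ gridSquare q → q ∉ S) {q q' : ℤ × ℤ} (hq : q ∈ U) (hxq : x ∈ gridSquare q)
    (hxq' : x ∈ gridSquare q') : q' ∈ U := by
  have hx1 := mem_gridSquare.1 hxq
  have hx2 := mem_gridSquare.1 hxq'
  have close : ∀ {a b : ℤ} {t : ℝ}, (a : ℝ) ≤ t ∧ t ≤ a + 1 → (b : ℝ) ≤ t ∧ t ≤ b + 1 →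
      a = b ∨ b = a + 1 ∨ a = b + 1 := by
    intro a b t h1 h2
    have e1 : (a : ℝ) ≤ b + 1 := h1.1.trans h2.2
    have e2 : (b : ℝ) ≤ a + 1 := h2.1.trans h1.2
    have e1' : a ≤ b + 1 := by exact_mod_cast e1
    have e2' : b ≤ a + 1 := by exact_mod_cast e2
    omega
  have hxm : x ∈ gridSquare (q'.1, q.2) := mem_gridSquare.2 ⟨hx2.1, hx1.2⟩
  have hm : (q'.1, q.2) ∈ U := by
    rcases close hx1.1 hx2.1 with h | h
    · rwa [← h]
    · exact hU q hq _ (hx _ hxm) (Or.inl ⟨rfl, h⟩)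
  rcases close hx1.2 hx2.2 with h | h
  · rwa [h] at hm
  · exact hU _ hm _ (hx _ hxq') (Or.inr ⟨rfl, h⟩)

/-- If `D` has no holes, then the grid squares outside `D` are connected to infinity. -/
theorem exists_gridRank {D : Set ℂ} (ho : IsOpen D)
    (hK : ∀ K : Set ℂ, IsCompact K → Disjoint K D → IsOpen (D ∪ K) → K = ∅)
    (B : Finset (ℤ × ℤ)) (hB : {q | gridSquare q ⊆ D} ⊆ (B : Set (ℤ × ℤ))) :
    ∃ ρ : ℤ × ℤ → ℕ, ∀ q ∈ B, q ∉ {q | gridSquare q ⊆ D} →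
      ∃ q', q' ∉ {q | gridSquare q ⊆ D} ∧ GridAdj q q' ∧ ρ q' < ρ q := by
  classical
  set S : Set (ℤ × ℤ) := {q | gridSquare q ⊆ D} with hS
  -- `R n` holds the squares joined to the exterior of `B` by `n` steps off `S`, and `U` below those
  -- that are never reached.
  let R : ℕ → Set (ℤ × ℤ) := fun n =>
    Nat.rec {q | q ∉ B} (fun _ T => {q | q ∉ S ∧ ∃ q' ∈ T, GridAdj q q'}) n
  have hRS : ∀ n, ∀ q ∈ R n, q ∉ S := by
    rintro (_ | n) q hq
    · exact fun h => hq (hB h)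
    · exact hq.1
  set U : Set (ℤ × ℤ) := {q | q ∉ S ∧ ∀ n, q ∉ R n} with hUdef
  have hUB : U ⊆ B := fun q hq => by_contra fun h => hq.2 0 h
  have hUfin : U.Finite := B.finite_toSet.subset hUB
  have hUcl : ∀ q ∈ U, ∀ q', q' ∉ S → GridAdj q q' → q' ∈ U := fun q hq q' hq' hadj =>
    ⟨hq', fun n hn => hq.2 (n + 1) ⟨hq.1, q', hn, hadj⟩⟩
  have hUe : U = ∅ := by
    -- `K` would be a hole. Near a point of `K`, a point off `D` lies in a square that shares that
    -- point with a square of `U`, hence in a square of `U`; so `D ∪ K` is open. But every square of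
    -- `U` has a point off `D`.
    set K : Set ℂ := (⋃ q ∈ U, gridSquare q) \ D with hKdef
    have hKc : IsCompact K := (hUfin.isCompact_biUnion fun q _ => isCompact_gridSquare q).diff ho
    have hKe := hK K hKc disjoint_sdiff_left (by
      rw [isOpen_iff_mem_nhds]
      rintro x hx
      by_cases hxD : x ∈ D
      · exact mem_of_superset (ho.mem_nhds hxD) subset_union_left
      · have hxK : x ∈ K := hx.resolve_left hxD
        obtain ⟨q, hqU, hxq⟩ := mem_iUnion₂.1 hxK.1
        filter_upwards [eventually_mem_gridSquare x] with y hy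
        by_cases hyD : y ∈ D
        · exact Or.inl hyD
        refine Or.inr ⟨mem_iUnion₂.2 ⟨gridFloor y, ?_, mem_gridSquare_gridFloor y⟩, hyD⟩
        exact gridAdj_closed_of_mem hUcl (fun p hp hpS => hxD (hpS hp)) hqU hxq hy)
    refine eq_empty_of_forall_notMem fun q hq => ?_
    obtain ⟨z, hz, hzD⟩ := not_subset.1 hq.1
    have : z ∈ K := ⟨mem_iUnion₂.2 ⟨q, hq, hz⟩, hzD⟩
    rw [hKe] at this
    exact this
  refine ⟨fun q => sInf {n | q ∈ R n}, fun q hqB hqS => ?_⟩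
  have hne : {n | q ∈ R n}.Nonempty := by
    by_contra h
    have : q ∈ U := ⟨hqS, fun n hn => h ⟨n, hn⟩⟩
    rw [hUe] at this
    exact this
  have hmem := Nat.sInf_mem hne
  rcases hk : sInf {n | q ∈ R n} with _ | k
  · rw [hk] at hmem
    exact absurd hqB hmem
  · rw [hk] at hmem
    obtain ⟨-, q', hq', hadj⟩ := hmem
    refine ⟨q', hRS k q' hq', hadj, ?_⟩
    simp only [hk]
    exact Nat.lt_succ_of_le (Nat.sInf_le hq')

/-! ### Potentials of cocycles on plane domains -/

section Cocycle

variable {Γ : Type*} [Group Γ] {D : Set ℂ}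

/-- On squares inside `D` the cocycle restricts to a flat cochain, which has a potential `φ` on the
vertices. It is carried to a point `x` by the value of `c` from the lower left corner of the square
of `x`. -/
theorem exists_potential_of_unit_grid (ho : IsOpen D) (hb : Bornology.IsBounded D)
    (hK : ∀ K : Set ℂ, IsCompact K → Disjoint K D → IsOpen (D ∪ K) → K = ∅) (c : ℂ → ℂ → Γ)
    (hc : ∀ W ⊆ D, Convex ℝ W → ∀ a ∈ W, ∀ b ∈ W, ∀ e ∈ W, c a b * c b e = c a e) (L : Set ℂ)
    (hL : ∀ x ∈ L, Metric.ball x 5 ⊆ D) :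
    ∃ ψ : ℂ → Γ, ∀ x ∈ L, ∀ y ∈ L, dist x y < 1 → ψ x * c x y = ψ y := by
  obtain ⟨r, hr⟩ := hb.subset_ball 0
  obtain ⟨N, hN⟩ := exists_nat_gt (r + 1)
  set S : Set (ℤ × ℤ) := {q | gridSquare q ⊆ D} with hS
  have hv : ∀ q : ℤ × ℤ, gridVertex q.1 q.2 ∈ gridSquare q ∧
      gridVertex (q.1 + 1) q.2 ∈ gridSquare q ∧ gridVertex q.1 (q.2 + 1) ∈ gridSquare q ∧
      gridVertex (q.1 + 1) (q.2 + 1) ∈ gridSquare q := fun q => by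
    simp [mem_gridSquare, gridVertex]
  have hSB : S ⊆ (Finset.Ico (-N : ℤ) N ×ˢ Finset.Ico (-N : ℤ) N : Finset (ℤ × ℤ)) := by
    intro q hq
    have h1 := hr (hq (hv q).1)
    rw [mem_ball_zero_iff] at h1
    have h2 := abs_le.1 (Complex.abs_re_le_norm (gridVertex q.1 q.2))
    have h3 := abs_le.1 (Complex.abs_im_le_norm (gridVertex q.1 q.2))
    simp only [gridVertex] at h1 h2 h3
    have e1 : ((-N : ℤ) : ℝ) ≤ q.1 := by push_cast; linarith
    have e2 : (q.1 : ℝ) < (N : ℤ) := by push_cast; linarith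
    have e3 : ((-N : ℤ) : ℝ) ≤ q.2 := by push_cast; linarith
    have e4 : (q.2 : ℝ) < (N : ℤ) := by push_cast; linarith
    simp only [Finset.coe_product, Finset.coe_Ico, mem_prod, mem_Ico]
    exact ⟨⟨by exact_mod_cast e1, by exact_mod_cast e2⟩,
      ⟨by exact_mod_cast e3, by exact_mod_cast e4⟩⟩
  obtain ⟨ρ, hρ⟩ := exists_gridRank ho hK _ hSB
  have hcS : ∀ q ∈ S, ∀ a ∈ gridSquare q, ∀ b ∈ gridSquare q, ∀ e ∈ gridSquare q,
      c a b * c b e = c a e := fun q hq => hc _ hq (convex_gridSquare q)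
  obtain ⟨φ, hφ⟩ := exists_gridPotential
    (fun i j => c (gridVertex i j) (gridVertex (i + 1) j))
    (fun i j => c (gridVertex i j) (gridVertex i (j + 1))) _ _ S hSB (by
      intro q hq
      obtain ⟨h1, h2, h3, h4⟩ := hv q
      unfold GridFlat
      rw [hcS q hq _ h1 _ h2 _ h4, hcS q hq _ h1 _ h3 _ h4]) ρ hρ
  have hcorner : ∀ q ∈ S, ∀ i j : ℤ, (i = q.1 ∨ i = q.1 + 1) → (j = q.2 ∨ j = q.2 + 1) →
      φ i j = φ q.1 q.2 * c (gridVertex q.1 q.2) (gridVertex i j) := by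
    intro q hq i j hi hj
    obtain ⟨h1, h2, h3, h4⟩ := hv q
    obtain ⟨p1, p2, p3, p4⟩ := hφ q hq
    have hone : c (gridVertex q.1 q.2) (gridVertex q.1 q.2) = 1 :=
      mul_eq_left.1 (hcS q hq _ h1 _ h1 _ h1)
    rcases hi with rfl | rfl <;> rcases hj with rfl | rfl
    · rw [hone, mul_one]
    · exact p3
    · exact p1
    · rw [p4, p1, mul_assoc, hcS q hq _ h1 _ h2 _ h4]
  refine ⟨fun x => φ (gridFloor x).1 (gridFloor x).2 *
    c (gridVertex (gridFloor x).1 (gridFloor x).2) x, fun x hx y hy hxy => ?_⟩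
  set p := gridFloor x with hp
  set p' := gridFloor y with hp'
  have hxp := mem_gridSquare.1 (mem_gridSquare_gridFloor x)
  have hyp := mem_gridSquare.1 (mem_gridSquare_gridFloor y)
  rw [← hp] at hxp
  rw [← hp'] at hyp
  rw [dist_eq_norm] at hxy
  have d1 := abs_lt.1 ((Complex.abs_re_le_norm (x - y)).trans_lt hxy)
  have d2 := abs_lt.1 ((Complex.abs_im_le_norm (x - y)).trans_lt hxy)
  rw [Complex.sub_re] at d1
  rw [Complex.sub_im] at d2
  have hclose : ∀ (t u : ℝ), t - u < 1 → ⌊t⌋ ≤ ⌊u⌋ + 1 := by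
    intro t u h
    have e : (⌊t⌋ : ℝ) < ⌊u⌋ + 1 + 1 := by
      linarith [Int.floor_le t, Int.lt_floor_add_one u]
    exact Int.lt_add_one_iff.1 (by exact_mod_cast e)
  have k1 : p.1 ≤ p'.1 + 1 := hclose _ _ d1.2
  have k2 : p.2 ≤ p'.2 + 1 := hclose _ _ d2.2
  have k3 : p'.1 ≤ p.1 + 1 := hclose _ _ (by linarith)
  have k4 : p'.2 ≤ p.2 + 1 := hclose _ _ (by linarith)
  -- This square has both corners `p` and `p'` among its vertices. Its points differ from `x` by at
  -- most 2 in each coordinate, so it lies in the ball of radius 5, where the cocycle identity is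
  -- available.
  set q : ℤ × ℤ := (min p.1 p'.1, min p.2 p'.2) with hq
  have q1 : q.1 = min p.1 p'.1 := rfl
  have q2 : q.2 = min p.2 p'.2 := rfl
  have hqW : gridSquare q ⊆ Metric.ball x 5 := by
    intro z hz
    have hz := mem_gridSquare.1 hz
    have m1 : (p.1 : ℝ) - 1 ≤ q.1 := by
      have : p.1 - 1 ≤ q.1 := by omega
      exact_mod_cast this
    have m2 : (q.1 : ℝ) ≤ p.1 := by
      have : q.1 ≤ p.1 := by omega
      exact_mod_cast this
    have m3 : (p.2 : ℝ) - 1 ≤ q.2 := by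
      have : p.2 - 1 ≤ q.2 := by omega
      exact_mod_cast this
    have m4 : (q.2 : ℝ) ≤ p.2 := by
      have : q.2 ≤ p.2 := by omega
      exact_mod_cast this
    rw [mem_ball_iff_norm]
    have n1 : |(z - x).re| ≤ 2 := abs_le.2 (by rw [Complex.sub_re]; constructor <;> linarith)
    have n2 : |(z - x).im| ≤ 2 := abs_le.2 (by rw [Complex.sub_im]; constructor <;> linarith)
    linarith [Complex.norm_le_abs_re_add_abs_im (z - x)]
  have hqS : q ∈ S := hqW.trans (hL x hx)
  have hcorn : ∀ a b : ℤ, (a = q.1 ∨ a = q.1 + 1) → (b = q.2 ∨ b = q.2 + 1) →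
      gridVertex a b ∈ gridSquare q := by
    obtain ⟨h1, h2, h3, h4⟩ := hv q
    rintro a b (rfl | rfl) (rfl | rfl) <;> assumption
  have a1 : p.1 = q.1 ∨ p.1 = q.1 + 1 := by omega
  have a2 : p.2 = q.2 ∨ p.2 = q.2 + 1 := by omega
  have a3 : p'.1 = q.1 ∨ p'.1 = q.1 + 1 := by omega
  have a4 : p'.2 = q.2 ∨ p'.2 = q.2 + 1 := by omega
  have hW := hc _ (hL x hx) (convex_ball x 5)
  have w0 := hqW (hv q).1
  have w1 := hqW (hcorn _ _ a1 a2)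
  have w2 := hqW (hcorn _ _ a3 a4)
  have wx : x ∈ Metric.ball x 5 := Metric.mem_ball_self (by norm_num)
  have wy : y ∈ Metric.ball x 5 := by
    rw [Metric.mem_ball, dist_comm, dist_eq_norm]
    linarith
  change φ p.1 p.2 * c (gridVertex p.1 p.2) x * c x y = φ p'.1 p'.2 * c (gridVertex p'.1 p'.2) y
  rw [hcorner q hqS _ _ a1 a2, hcorner q hqS _ _ a3 a4, mul_assoc, mul_assoc, mul_assoc,
    hW _ w1 _ wx _ wy, hW _ w0 _ w1 _ wy, hW _ w0 _ w2 _ wy]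

/-- A locally trivial cocycle on a plane domain without holes is trivial near a compact set. -/
theorem exists_potential_of_no_holes (ho : IsOpen D) (hb : Bornology.IsBounded D)
    (hK : ∀ K : Set ℂ, IsCompact K → Disjoint K D → IsOpen (D ∪ K) → K = ∅) (c : ℂ → ℂ → Γ)
    (hc : ∀ W ⊆ D, Convex ℝ W → ∀ a ∈ W, ∀ b ∈ W, ∀ e ∈ W, c a b * c b e = c a e) (L : Set ℂ)
    (hL : IsCompact L) (hLD : L ⊆ D) :
    ∃ ε > 0, (∀ x ∈ L, Metric.ball x ε ⊆ D) ∧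
      ∃ ψ : ℂ → Γ, ∀ x ∈ L, ∀ y ∈ L, dist x y < ε → ψ x * c x y = ψ y := by
  obtain ⟨η, hη, hthick⟩ := hL.exists_thickening_subset_open ho hLD
  have hball : ∀ x ∈ L, Metric.ball x η ⊆ D := fun x hx =>
    (Metric.ball_subset_thickening hx η).trans hthick
  -- Scaling by `δ` turns the room `η` around `L` into the radius 5 of the unit grid.
  set δ : ℝ := η / 5 with hδ
  have hδ0 : 0 < δ := by positivity
  have hδC : (δ : ℂ) ≠ 0 := by exact_mod_cast hδ0.ne'
  let m : ℂ ≃ₜ ℂ := Homeomorph.mulLeft₀ (δ : ℂ) hδC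
  have hm : ∀ z, m z = δ * z := fun z => rfl
  have hdist : ∀ z w, dist (m z) (m w) = δ * dist z w := fun z w => by
    rw [hm, hm, dist_eq_norm, ← mul_sub, norm_mul, Complex.norm_real, Real.norm_of_nonneg hδ0.le,
      dist_eq_norm]
  have hlip : ∀ z, dist z 0 = δ⁻¹ * dist (m z) 0 := fun z => by
    have := hdist z 0
    rw [hm 0, mul_zero] at this
    rw [this]
    field_simp
  obtain ⟨ψ, hψ⟩ := exists_potential_of_unit_grid (D := m ⁻¹' D) (ho.preimage m.continuous)
    (by
      obtain ⟨r, hr⟩ := hb.subset_ball 0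
      refine (Metric.isBounded_ball (x := (0 : ℂ)) (r := δ⁻¹ * r)).subset fun z hz => ?_
      have := hr hz
      rw [Metric.mem_ball] at this ⊢
      rw [hlip]
      gcongr)
    (by
      intro K hKc hKd hKo
      have := hK (m '' K) (hKc.image m.continuous)
        (by
          rw [Set.disjoint_left] at hKd ⊢
          rintro _ ⟨z, hz, rfl⟩ h
          exact hKd hz h)
        (by
          have := m.isOpenMap _ hKo
          rwa [image_union, image_preimage_eq D m.surjective] at this)
      exact image_eq_empty.1 this)
    (fun z w => c (m z) (m w))
    (by
      intro W hW hconv a ha b hb e he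
      refine hc (m '' W) (image_subset_iff.2 hW) ?_ _ (mem_image_of_mem _ ha) _
        (mem_image_of_mem _ hb) _ (mem_image_of_mem _ he)
      have : m '' W = (fun z => δ • z) '' W := image_congr fun z _ => by
        rw [hm, Complex.real_smul]
      rw [this]
      exact hconv.smul δ)
    (m ⁻¹' L)
    (by
      intro x hx z hz
      refine hball _ hx ?_
      rw [Metric.mem_ball] at hz ⊢
      rw [hdist]
      calc δ * dist z x < δ * 5 := by gcongr
        _ = η := by rw [hδ]; ring)
  refine ⟨δ, hδ0, fun x hx => (Metric.ball_subset_ball (by rw [hδ]; linarith)).trans (hball x hx),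
    fun x => ψ (m.symm x), fun x hx y hy hxy => ?_⟩
  have := hψ (m.symm x) (by simpa using hx) (m.symm y) (by simpa using hy) (by
    have h := hdist (m.symm x) (m.symm y)
    rw [m.apply_symm_apply, m.apply_symm_apply] at h
    rw [h] at hxy
    by_contra hcon
    push Not at hcon
    nlinarith)
  simpa using this

end Cocycle

/-! ### Simple connectivity from the absence of holes -/

/-- The homotopy class of a path, as an arrow of the fundamental groupoid. -/
def pathArrow {X : Type*} [TopologicalSpace X] {a b : X} (p : Path a b) :
    FundamentalGroupoid.mk a ⟶ FundamentalGroupoid.mk b :=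
  Path.Homotopic.Quotient.mk p

section Homotopy

open CategoryTheory

theorem pathArrow_eq_iff {X : Type*} [TopologicalSpace X] {a b : X} {p q : Path a b} :
    pathArrow p = pathArrow q ↔ p.Homotopic q :=
  Path.Homotopic.Quotient.eq

theorem pathArrow_trans {X : Type*} [TopologicalSpace X] {a b e : X} (p : Path a b)
    (q : Path b e) : pathArrow (p.trans q) = pathArrow p ≫ pathArrow q :=
  Path.Homotopic.Quotient.mk_trans p q

theorem pathArrow_refl {X : Type*} [TopologicalSpace X] (a : X) :
    pathArrow (Path.refl a) = 𝟙 (FundamentalGroupoid.mk a) :=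
  rfl

/-- Paths inside a convex set are homotopic. -/
theorem homotopic_of_convex {D W : Set ℂ} (hWD : W ⊆ D) (hW : Convex ℝ W) {a b : D}
    (p q : Path a b) (hp : ∀ t, (p t : ℂ) ∈ W) (hq : ∀ t, (q t : ℂ) ∈ W) : p.Homotopic q := by
  have ha : (a : ℂ) ∈ W := by simpa using hp 0
  have hb : (b : ℂ) ∈ W := by simpa using hp 1
  have : ContractibleSpace W := hW.contractibleSpace ⟨a, ha⟩
  let lift : ∀ r : Path a b, (∀ t, (r t : ℂ) ∈ W) → Path (⟨a, ha⟩ : W) ⟨b, hb⟩ := fun r hr =>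
    { toFun := fun t => ⟨r t, hr t⟩
      source' := by simp
      target' := by simp }
  have h := SimplyConnectedSpace.paths_homotopic (lift p hp) (lift q hq)
  have h2 := h.map ⟨inclusion hWD, continuous_inclusion hWD⟩
  exact h2

/-- The straight path between two points of `D` whose segment lies in `D`. -/
noncomputable def segmentPath {D : Set ℂ} (a b : D) (h : segment ℝ (a : ℂ) b ⊆ D) : Path a b where
  toFun t := ⟨Path.segment (a : ℂ) b t, h (by
    rw [← Path.range_segment]; exact mem_range_self t)⟩
  source' := by simp
  target' := by simp

theorem segmentPath_mem {D : Set ℂ} (a b : D) (h : segment ℝ (a : ℂ) b ⊆ D) (t) :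
    (segmentPath a b h t : ℂ) ∈ segment ℝ (a : ℂ) b := by
  rw [← Path.range_segment]
  exact mem_range_self t

open Classical in
/-- The class of the loop at `x₀` that runs to `b`, straight on to `a`, and back. -/
noncomputable def loopCocycle {D : Set ℂ} {x₀ : D}
    (p : ∀ x : D, FundamentalGroupoid.mk x₀ ⟶ FundamentalGroupoid.mk x) (a b : ℂ) :
    FundamentalGroup D x₀ :=
  if h : segment ℝ b a ⊆ D then
    p ⟨b, h (left_mem_segment ℝ b a)⟩ ≫
      pathArrow (segmentPath ⟨b, h (left_mem_segment ℝ b a)⟩ ⟨a, h (right_mem_segment ℝ b a)⟩ h) ≫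
      inv (p ⟨a, h (right_mem_segment ℝ b a)⟩)
  else 1

theorem loopCocycle_eq {D : Set ℂ} {x₀ : D}
    (p : ∀ x : D, FundamentalGroupoid.mk x₀ ⟶ FundamentalGroupoid.mk x) {W : Set ℂ} (hWD : W ⊆ D)
    (hW : Convex ℝ W) (a b : D) (q : Path b a) (hq : ∀ t, (q t : ℂ) ∈ W) :
    loopCocycle p a b = p b ≫ pathArrow q ≫ inv (p a) := by
  have ha : (a : ℂ) ∈ W := by simpa using hq 1
  have hb : (b : ℂ) ∈ W := by simpa using hq 0
  have hseg : segment ℝ (b : ℂ) a ⊆ W := hW.segment_subset hb ha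
  unfold loopCocycle
  rw [dif_pos (hseg.trans hWD)]
  have : pathArrow (segmentPath b a (hseg.trans hWD)) = pathArrow q :=
    pathArrow_eq_iff.2 (homotopic_of_convex hWD hW _ _
      (fun t => hseg (segmentPath_mem _ _ _ t)) hq)
  rw [← this]

/-- The product of `End` composes from right to left, which is why the loop of `a b` runs from `b`
to `a`. The return to `b` cancels, and the two segments may be replaced by one inside the convex
set. -/
theorem loopCocycle_mul {D : Set ℂ} {x₀ : D}
    (p : ∀ x : D, FundamentalGroupoid.mk x₀ ⟶ FundamentalGroupoid.mk x) (W : Set ℂ) (hWD : W ⊆ D)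
    (hW : Convex ℝ W) (a : ℂ) (ha : a ∈ W) (b : ℂ) (hb : b ∈ W) (e : ℂ) (he : e ∈ W) :
    loopCocycle p a b * loopCocycle p b e = loopCocycle p a e := by
  have hba : segment ℝ b a ⊆ W := hW.segment_subset hb ha
  have heb : segment ℝ e b ⊆ W := hW.segment_subset he hb
  let qba := segmentPath (⟨b, hWD hb⟩ : D) ⟨a, hWD ha⟩ (hba.trans hWD)
  let qeb := segmentPath (⟨e, hWD he⟩ : D) ⟨b, hWD hb⟩ (heb.trans hWD)
  have h1 : ∀ t, (qba t : ℂ) ∈ W := fun t =>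
    hba (segmentPath_mem (⟨b, hWD hb⟩ : D) ⟨a, hWD ha⟩ (hba.trans hWD) t)
  have h2 : ∀ t, (qeb t : ℂ) ∈ W := fun t =>
    heb (segmentPath_mem (⟨e, hWD he⟩ : D) ⟨b, hWD hb⟩ (heb.trans hWD) t)
  have h3 : ∀ t, ((qeb.trans qba) t : ℂ) ∈ W := by
    intro t
    have : (qeb.trans qba) t ∈ range qeb ∪ range qba := by
      rw [← Path.trans_range]; exact mem_range_self t
    rcases this with ⟨s, hs⟩ | ⟨s, hs⟩
    · rw [← hs]; exact h2 s
    · rw [← hs]; exact h1 s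
  rw [loopCocycle_eq p hWD hW ⟨a, hWD ha⟩ ⟨b, hWD hb⟩ qba h1,
    loopCocycle_eq p hWD hW ⟨b, hWD hb⟩ ⟨e, hWD he⟩ qeb h2,
    loopCocycle_eq p hWD hW ⟨a, hWD ha⟩ ⟨e, hWD he⟩ (qeb.trans qba) h3, pathArrow_trans]
  rw [End.mul_def]
  simp

theorem homotopic_refl_of_cast {X : Type*} [TopologicalSpace X] {x₀ x y₀ y₁ : X} (γ : Path x x)
    (h0 : y₀ = x) (h1 : y₁ = x)
    (p : ∀ x : X, FundamentalGroupoid.mk x₀ ⟶ FundamentalGroupoid.mk x)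
    (h : p y₀ ≫ pathArrow (γ.cast h0 h1) ≫ inv (p y₁) = 𝟙 _) : γ.Homotopic (Path.refl x) := by
  subst h0
  subst h1
  rw [← pathArrow_eq_iff, pathArrow_refl]
  have h2 : p y₁ ≫ pathArrow γ ≫ inv (p y₁) = 𝟙 _ := h
  rw [← Category.assoc, IsIso.comp_inv_eq, Category.id_comp] at h2
  exact (cancel_epi (p y₁)).1 (by rw [h2, Category.comp_id])

/-- A bounded plane domain without holes is simply connected. -/
theorem isSimplyConnected_of_no_holes {D : Set ℂ} (ho : IsOpen D) (hb : Bornology.IsBounded D)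
    (hc : IsConnected D)
    (hK : ∀ K : Set ℂ, IsCompact K → Disjoint K D → IsOpen (D ∪ K) → K = ∅) :
    IsSimplyConnected D := by
  have hpc : PathConnectedSpace D :=
    isPathConnected_iff_pathConnectedSpace.1 (ho.isConnected_iff_isPathConnected.1 hc)
  refine simply_connected_iff_loops_nullhomotopic.2 ⟨hpc, fun x γ => ?_⟩
  let p : ∀ y : D, FundamentalGroupoid.mk x ⟶ FundamentalGroupoid.mk y := fun y =>
    pathArrow (PathConnectedSpace.somePath x y)
  have hγc : Continuous fun t => (γ t : ℂ) := continuous_subtype_val.comp γ.continuous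
  obtain ⟨ε, hε, hball, ψ, hψ⟩ := exists_potential_of_no_holes ho hb hK (loopCocycle p)
    (loopCocycle_mul p) (range fun t => (γ t : ℂ)) (isCompact_range hγc)
    (range_subset_iff.2 fun t => (γ t).2)
  -- The initial piece of `γ`, closed up by the reference paths. A short step multiplies `g` on the
  -- left by a value of the cocycle, and `ψ` absorbs it; so `ψ (γ t) * g t` is constant. As `γ` is
  -- closed and `g 0 = 1`, also `g 1 = 1`.
  let g : unitInterval → FundamentalGroup D x := fun t =>
    p (γ 0) ≫ pathArrow (γ.subpath 0 t) ≫ inv (p (γ t))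
  have hstep : ∀ t t', (∀ u ∈ uIcc t t', (γ u : ℂ) ∈ Metric.ball (γ t : ℂ) ε) →
      ψ (γ t') * g t' = ψ (γ t) * g t := by
    intro t t' h
    have hdist : dist (γ t' : ℂ) (γ t) < ε := h t' right_mem_uIcc
    have hq : ∀ s, ((γ.subpath t t') s : ℂ) ∈ Metric.ball (γ t : ℂ) ε := by
      intro s
      have : (γ.subpath t t') s ∈ γ '' uIcc t t' := by
        rw [← Path.range_subpath]; exact mem_range_self s
      obtain ⟨u, hu, hu'⟩ := this
      rw [← hu']
      exact h u hu
    have hg : g t' = loopCocycle p (γ t') (γ t) * g t := by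
      rw [loopCocycle_eq p (hball _ (mem_range_self t)) (convex_ball _ _) (γ t') (γ t)
        (γ.subpath t t') hq, End.mul_def]
      have := pathArrow_eq_iff.2 ⟨Path.Homotopy.subpathTransSubpath γ 0 t t'⟩
      rw [pathArrow_trans] at this
      simp only [g]
      rw [← this]
      simp
    rw [hg, ← mul_assoc, hψ _ (mem_range_self t') _ (mem_range_self t) hdist]
  have hloc : IsLocallyConstant fun t => ψ (γ t) * g t := by
    rw [IsLocallyConstant.iff_eventually_eq]
    intro t
    have hev : (fun t => (γ t : ℂ)) ⁻¹' Metric.ball (γ t : ℂ) ε ∈ 𝓝 t :=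
      hγc.continuousAt.preimage_mem_nhds (Metric.ball_mem_nhds _ hε)
    have := ((tendsto_const_nhds (x := t) (f := 𝓝 t)).uIcc tendsto_id).eventually
      (eventually_smallSets_subset.2 hev)
    filter_upwards [this] with t' ht'
    exact hstep t t' fun u hu => ht' hu
  have h01 := hloc.apply_eq_of_isPreconnected isPreconnected_univ (mem_univ 1) (mem_univ 0)
  have hg0 : g 0 = 1 := by
    simp only [g, Path.subpath_self, pathArrow_refl]
    simp [End.one_def]
  have e : ψ (γ 1) = ψ (γ 0) := by rw [γ.source, γ.target]
  have hg1 : g 1 = 1 := by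
    have h2 : ψ (γ 1) * g 1 = ψ (γ 0) * g 0 := h01
    rw [e, hg0] at h2
    exact mul_left_cancel h2
  refine homotopic_refl_of_cast γ γ.source γ.target p ?_
  rw [← Path.subpath_zero_one]
  exact hg1

end Homotopy

/-! ### The Green function -/

section Green

variable {P : ℂ[X]}

theorem exists_abs_greenFunction_sub_posLog_le (P : ℂ[X]) (hP : 2 ≤ P.natDegree) :
    ∃ M : ℝ, 0 ≤ M ∧ ∀ z : ℂ, |greenFunction P z - Real.posLog ‖z‖| ≤ M := by
  obtain ⟨M, hM⟩ := exists_bound_posLog_eval P hP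
  have hM0 : 0 ≤ M := (abs_nonneg _).trans (hM 0)
  have hd : (2 : ℝ) ≤ P.natDegree := by exact_mod_cast hP
  set d : ℝ := (P.natDegree : ℝ)
  have hd0 : 0 < d := by linarith
  refine ⟨M, hM0, fun z => ?_⟩
  -- A step adds at most `M / d ^ (n + 1)`, while the right side grows by `d - 1 ≥ 1` times this
  -- amount.
  have hn : ∀ n : ℕ, |Real.posLog ‖(fun w => P.eval w)^[n] z‖ / d ^ n - Real.posLog ‖z‖| ≤
      M * (1 - (d ^ n)⁻¹) := by
    intro n
    induction n with
    | zero => simp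
    | succ n ih =>
      rw [Function.iterate_succ_apply']
      set w := (fun w => P.eval w)^[n] z
      have h1 := hM w
      have hdn : 0 < d ^ n := by positivity
      have e : Real.posLog ‖P.eval w‖ / d ^ (n + 1) - Real.posLog ‖z‖
          = (Real.posLog ‖P.eval w‖ - d * Real.posLog ‖w‖) / d ^ (n + 1)
            + (Real.posLog ‖w‖ / d ^ n - Real.posLog ‖z‖) := by
        field_simp
        ring
      rw [e]
      refine (abs_add_le _ _).trans ?_
      rw [abs_div, abs_of_pos (show 0 < d ^ (n + 1) by positivity)]
      have h2 : |Real.posLog ‖P.eval w‖ - d * Real.posLog ‖w‖| / d ^ (n + 1) ≤ M / d ^ (n + 1) := by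
        gcongr
      have h3 : M * (1 - (d ^ (n + 1))⁻¹) - M * (1 - (d ^ n)⁻¹) = M / d ^ (n + 1) * (d - 1) := by
        field_simp
        ring
      have h4 : M / d ^ (n + 1) ≤ M / d ^ (n + 1) * (d - 1) :=
        le_mul_of_one_le_right (by positivity) (by linarith)
      linarith
  have hlim := ((tendsto_greenFunction P hP z).sub_const (Real.posLog ‖z‖)).abs
  refine le_of_tendsto hlim (Eventually.of_forall fun n => (hn n).trans ?_)
  have : 0 < (d ^ n)⁻¹ := by positivity
  nlinarith

theorem greenFunction_eval (hP : 2 ≤ P.natDegree) (z : ℂ) :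
    greenFunction P (P.eval z) = P.natDegree * greenFunction P z := by
  have hd : (0 : ℝ) < P.natDegree := by
    have : 0 < P.natDegree := by omega
    exact_mod_cast this
  have h1 := tendsto_greenFunction P hP (P.eval z)
  have h2 := ((tendsto_greenFunction P hP z).comp (tendsto_add_atTop_nat 1)).const_mul
    (P.natDegree : ℝ)
  refine tendsto_nhds_unique h1 (h2.congr fun n => ?_)
  simp only [Function.comp, Function.iterate_succ_apply]
  rw [pow_succ]
  field_simp

theorem greenFunction_iterate (hP : 2 ≤ P.natDegree) (n : ℕ) (z : ℂ) :
    greenFunction P ((fun w => P.eval w)^[n] z) = P.natDegree ^ n * greenFunction P z := by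
  induction n with
  | zero => simp
  | succ n ih => rw [Function.iterate_succ_apply', greenFunction_eval hP, ih, pow_succ]; ring

theorem greenFunction_nonneg (hP : 2 ≤ P.natDegree) (z : ℂ) : 0 ≤ greenFunction P z :=
  ge_of_tendsto' (tendsto_greenFunction P hP z) fun _ =>
    div_nonneg Real.posLog_nonneg (by positivity)

theorem continuous_iterate_eval (P : ℂ[X]) (n : ℕ) : Continuous (fun w => P.eval w)^[n] :=
  P.continuous.iterate n

/-- The bound on `G - log⁺` at the `n`-th iterate, divided by `d ^ n`, makes the convergence
uniform. -/
theorem continuous_greenFunction (hP : 2 ≤ P.natDegree) : Continuous (greenFunction P) := by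
  obtain ⟨M, hM0, hM⟩ := exists_abs_greenFunction_sub_posLog_le P hP
  have hd : (2 : ℝ) ≤ P.natDegree := by exact_mod_cast hP
  have hu : TendstoUniformly
      (fun (n : ℕ) z => Real.posLog ‖(fun w => P.eval w)^[n] z‖ / (P.natDegree : ℝ) ^ n)
      (greenFunction P) atTop := by
    rw [Metric.tendstoUniformly_iff]
    intro ε hε
    have h0 : Tendsto (fun n : ℕ => M * ((P.natDegree : ℝ)⁻¹) ^ n) atTop (𝓝 (M * 0)) :=
      (tendsto_pow_atTop_nhds_zero_of_lt_one (by positivity)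
        (inv_lt_one_of_one_lt₀ (by linarith))).const_mul M
    rw [mul_zero] at h0
    filter_upwards [h0.eventually (gt_mem_nhds hε)] with n hn z
    refine lt_of_le_of_lt ?_ hn
    have h1 := hM ((fun w => P.eval w)^[n] z)
    rw [greenFunction_iterate hP] at h1
    have hdn : (0 : ℝ) < (P.natDegree : ℝ) ^ n := by positivity
    have e : greenFunction P z - Real.posLog ‖(fun w => P.eval w)^[n] z‖ / (P.natDegree : ℝ) ^ n
        = (P.natDegree ^ n * greenFunction P z - Real.posLog ‖(fun w => P.eval w)^[n] z‖)
          / (P.natDegree : ℝ) ^ n := by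
      field_simp
    rw [Real.dist_eq, inv_pow, ← div_eq_mul_inv, e, abs_div, abs_of_pos hdn]
    gcongr
  refine hu.continuous (Frequently.of_forall fun n => ?_)
  have := continuous_iterate_eval P n
  have := Real.continuous_posLog
  fun_prop

theorem isBounded_greenFunction_le (hP : 2 ≤ P.natDegree) (s : ℝ) :
    Bornology.IsBounded {z | greenFunction P z ≤ s} := by
  obtain ⟨M, hM0, hM⟩ := exists_abs_greenFunction_sub_posLog_le P hP
  refine (Metric.isBounded_closedBall (x := (0 : ℂ)) (r := Real.exp (s + M))).subset fun z hz => ?_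
  rw [mem_closedBall_zero_iff]
  have h1 := (abs_le.1 (hM z)).1
  have h2 : greenFunction P z ≤ s := hz
  have h3 : Real.log ‖z‖ ≤ Real.posLog ‖z‖ := le_max_right _ _
  rcases eq_or_ne ‖z‖ 0 with h0 | h0
  · rw [h0]; positivity
  · exact (Real.log_le_iff_le_exp (by positivity)).1 (by linarith)

/-- Along an orbit `G` is multiplied by `d`, whereas `G` is bounded exactly on bounded sets, being
within a bounded distance of `log⁺`. -/
theorem greenFunction_eq_zero_iff (hP : 2 ≤ P.natDegree) (z : ℂ) :
    greenFunction P z = 0 ↔ z ∈ filledJuliaSet P := by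
  constructor
  · intro h
    refine (isBounded_greenFunction_le hP 0).subset ?_
    rintro _ ⟨n, rfl⟩
    simp [greenFunction_iterate hP, h]
  · intro h
    obtain ⟨M, hM0, hM⟩ := exists_abs_greenFunction_sub_posLog_le P hP
    obtain ⟨r, hr⟩ := (show Bornology.IsBounded (range fun n : ℕ => (fun w => P.eval w)^[n] z) from h).subset_closedBall 0
    have hd : (2 : ℝ) ≤ P.natDegree := by exact_mod_cast hP
    refine le_antisymm ?_ (greenFunction_nonneg hP z)
    by_contra! hpos
    have hbd : ∀ n : ℕ, (P.natDegree : ℝ) ^ n * greenFunction P z ≤ M + Real.posLog r := by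
      intro n
      have h1 := hr (mem_range_self n)
      rw [mem_closedBall_zero_iff] at h1
      have h2 := (abs_le.1 (hM ((fun w => P.eval w)^[n] z))).2
      rw [greenFunction_iterate hP] at h2
      have h3 := Real.posLog_le_posLog (norm_nonneg _) h1
      linarith
    have ht := (tendsto_pow_atTop_atTop_of_one_lt (r := (P.natDegree : ℝ))
      (by linarith)).atTop_mul_const hpos
    obtain ⟨n, hn⟩ := (ht.eventually_gt_atTop (M + Real.posLog r)).exists
    exact absurd (hbd n) (not_le.2 hn)

/-- Far out `P w` is comparable to its leading term `a * w ^ d`, so `‖P w‖ ≥ ‖a‖ * ‖w‖ ^ 2 / 2 ≥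
‖w‖` once `‖w‖ > 2 / ‖a‖`. The bound `1 / 2` keeps the quotient in the slit plane, where its
logarithm is holomorphic. -/
theorem exists_escape_radius (hP : 2 ≤ P.natDegree) :
    ∃ R : ℝ, 1 ≤ R ∧ ∀ w : ℂ, R < ‖w‖ →
      R < ‖P.eval w‖ ∧ ‖P.eval w / (P.leadingCoeff * w ^ P.natDegree) - 1‖ ≤ 1 / 2 := by
  have hP0 : P ≠ 0 := by rintro rfl; simp at hP
  have hlc : P.leadingCoeff ≠ 0 := leadingCoeff_ne_zero.mpr hP0
  have hlcn : 0 < ‖P.leadingCoeff‖ := norm_pos_iff.2 hlc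
  have h1 : Tendsto (fun z : ℂ => P.eval z / z ^ P.natDegree / P.leadingCoeff) (cocompact ℂ)
      (𝓝 1) := by
    have := (tendsto_eval_div_pow P).div_const P.leadingCoeff
    rwa [div_self hlc] at this
  have h2 := h1.eventually (Metric.closedBall_mem_nhds 1 (show (0 : ℝ) < 1 / 2 by norm_num))
  rw [← Metric.cobounded_eq_cocompact, ← comap_norm_atTop, eventually_comap] at h2
  obtain ⟨R₀, hR₀⟩ := eventually_atTop.1 h2
  refine ⟨max 1 (max R₀ (2 / ‖P.leadingCoeff‖)), le_max_left _ _, fun w hw => ?_⟩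
  have hw1 : 1 < ‖w‖ := (le_max_left _ _).trans_lt hw
  have hw2 : R₀ < ‖w‖ := ((le_max_left _ _).trans (le_max_right _ _)).trans_lt hw
  have hw3 : 2 / ‖P.leadingCoeff‖ < ‖w‖ := ((le_max_right _ _).trans (le_max_right _ _)).trans_lt hw
  have h3 := hR₀ ‖w‖ hw2.le w rfl
  rw [dist_eq_norm, div_div, mul_comm (w ^ _)] at h3
  refine ⟨hw.trans_le ?_, h3⟩
  have hw0 : w ≠ 0 := norm_pos_iff.1 (by linarith)
  set u := P.eval w / (P.leadingCoeff * w ^ P.natDegree) with hu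
  have hu2 : 1 / 2 ≤ ‖u‖ := by
    have := norm_sub_norm_le (1 : ℂ) u
    rw [norm_sub_rev, norm_one] at this
    linarith
  have e : P.eval w = u * P.leadingCoeff * w ^ P.natDegree := by
    rw [hu]
    field_simp
  rw [e, norm_mul, norm_mul, norm_pow]
  have h4 : ‖w‖ ^ 2 ≤ ‖w‖ ^ P.natDegree := pow_le_pow_right₀ hw1.le hP
  rw [div_lt_iff₀ hlcn] at hw3
  calc ‖w‖ ≤ 1 / 2 * (‖w‖ * ‖P.leadingCoeff‖) * ‖w‖ := by nlinarith
    _ = 1 / 2 * ‖P.leadingCoeff‖ * ‖w‖ ^ 2 := by ring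
    _ ≤ _ := by gcongr

/-- Near infinity, the Green function is `log ‖z‖` plus the real part of a holomorphic function. -/
theorem exists_greenFunction_eq_log_add_re (hP : 2 ≤ P.natDegree) {R : ℝ} (hR : 1 ≤ R)
    (hPR : ∀ w : ℂ, R < ‖w‖ →
      R < ‖P.eval w‖ ∧ ‖P.eval w / (P.leadingCoeff * w ^ P.natDegree) - 1‖ ≤ 1 / 2) :
    ∃ H : ℂ → ℂ, DifferentiableOn ℂ H {z | R < ‖z‖} ∧
      ∀ z, R < ‖z‖ → greenFunction P z = Real.log ‖z‖ + (H z).re := by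
  have hP0 : P ≠ 0 := by rintro rfl; simp at hP
  have hlc : P.leadingCoeff ≠ 0 := leadingCoeff_ne_zero.mpr hP0
  have hd : (2 : ℝ) ≤ P.natDegree := by exact_mod_cast hP
  set d := P.natDegree with hdd
  have hdpos : (0 : ℝ) < d := by linarith
  have hdC : (d : ℂ) ≠ 0 := by exact_mod_cast hdpos.ne'
  set U : Set ℂ := {z | R < ‖z‖} with hU
  have hUo : IsOpen U := isOpen_lt continuous_const continuous_norm
  have hU0 : ∀ z ∈ U, z ≠ 0 := fun z hz => norm_pos_iff.1 (by
    have : R < ‖z‖ := hz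
    linarith)
  have hit : ∀ n : ℕ, MapsTo (fun w => P.eval w)^[n] U U := fun n =>
    MapsTo.iterate (fun w hw => (hPR w hw).1) n
  let r : ℂ → ℂ := fun w => P.eval w / (P.leadingCoeff * w ^ d)
  let q : ℂ → ℂ := fun w => Complex.log (r w) + Complex.log P.leadingCoeff
  have hslit : ∀ w ∈ U, r w ∈ Complex.slitPlane := fun w hw => by
    have h1 := (Complex.abs_re_le_norm _).trans (hPR w hw).2
    rw [Complex.sub_re, Complex.one_re] at h1
    left
    have := (abs_le.1 h1).1
    change 0 < (P.eval w / (P.leadingCoeff * w ^ d)).re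
    linarith
  have hqd : DifferentiableOn ℂ q U := by
    intro w hw
    refine ((DifferentiableAt.clog ?_ (hslit w hw)).add_const _).differentiableWithinAt
    refine P.differentiable.differentiableAt.div (by fun_prop) ?_
    exact mul_ne_zero hlc (pow_ne_zero _ (hU0 w hw))
  have hqb : ∀ w ∈ U, ‖q w‖ ≤ 3 / 2 * (1 / 2) + ‖Complex.log P.leadingCoeff‖ := by
    intro w hw
    refine (norm_add_le _ _).trans ?_
    have h1 := Complex.norm_log_one_add_half_le_self (hPR w hw).2
    rw [add_sub_cancel] at h1
    gcongr
    exact h1.trans (by gcongr; exact (hPR w hw).2)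
  have hqre : ∀ w ∈ U, (q w).re = Real.log ‖P.eval w‖ - d * Real.log ‖w‖ := by
    intro w hw
    have hw0 := hU0 w hw
    have hPw0 := hU0 _ (hit 1 hw)
    simp only [Function.iterate_one] at hPw0
    simp only [q, r, Complex.add_re, Complex.log_re, norm_div, norm_mul, norm_pow]
    rw [Real.log_div (by simpa using hPw0) (by simp [hlc, hw0]),
      Real.log_mul (by simpa using hlc) (by simp [hw0]), Real.log_pow]
    ring
  -- Since `q w` has real part `log ‖P w‖ - d * log ‖w‖`, the real parts of the partial sums
  -- telescope to `log ‖Pⁿ z‖ / d ^ n - log ‖z‖`.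
  let T : ℕ → ℂ → ℂ := fun n z => ((d : ℂ)⁻¹) ^ (n + 1) * q ((fun w => P.eval w)^[n] z)
  set A := 3 / 2 * (1 / 2) + ‖Complex.log P.leadingCoeff‖
  have hTb : ∀ n, ∀ z ∈ U, ‖T n z‖ ≤ ((d : ℝ)⁻¹) ^ (n + 1) * A := by
    intro n z hz
    simp only [T, norm_mul, norm_pow, norm_inv, Complex.norm_natCast]
    gcongr
    exact hqb _ (hit n hz)
  have hsum : Summable fun n : ℕ => ((d : ℝ)⁻¹) ^ (n + 1) * A := by
    refine Summable.mul_right _ ?_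
    exact (summable_nat_add_iff 1).2 (summable_geometric_of_lt_one (by positivity)
      (inv_lt_one_of_one_lt₀ (by linarith)))
  refine ⟨fun z => ∑' n, T n z, Complex.differentiableOn_tsum_of_summable_norm hsum (fun n => ?_) hUo hTb,
    fun z hz => ?_⟩
  · refine DifferentiableOn.const_mul (hqd.comp ?_ (hit n)) _
    exact (P.differentiable.iterate n).differentiableOn
  · have hs : Summable fun n => T n z := Summable.of_norm_bounded hsum fun n => hTb n z hz
    have h1 := (Complex.hasSum_re hs.hasSum).tendsto_sum_nat
    have hpart : ∀ n : ℕ, ∑ i ∈ Finset.range n, (T i z).re =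
        Real.posLog ‖(fun w => P.eval w)^[n] z‖ / (d : ℝ) ^ n - Real.log ‖z‖ := by
      intro n
      have hpl : ∀ w ∈ U, Real.posLog ‖w‖ = Real.log ‖w‖ := fun w hw =>
        Real.posLog_eq_log (by
          rw [abs_norm]
          exact hR.trans (le_of_lt hw))
      rw [hpl _ (hit n hz)]
      induction n with
      | zero => simp
      | succ n ih =>
        rw [Finset.sum_range_succ, ih]
        have e : (T n z).re = ((d : ℝ)⁻¹) ^ (n + 1) * (q ((fun w => P.eval w)^[n] z)).re := by
          simp only [T]
          rw [← Complex.re_ofReal_mul]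
          push_cast
          rfl
        rw [e, hqre _ (hit n hz), Function.iterate_succ_apply', inv_pow]
        field_simp
        ring
    have h2 := (tendsto_greenFunction P hP z).sub_const (Real.log ‖z‖)
    have h3 := tendsto_nhds_unique h1 (h2.congr fun n => (hpart n).symm)
    rw [h3]
    ring

/-- Off the filled Julia set, the Green function is locally the real part of a holomorphic
function. -/
theorem exists_analyticAt_greenFunction_eq_re (hP : 2 ≤ P.natDegree) {z₀ : ℂ}
    (hz₀ : 0 < greenFunction P z₀) :
    ∃ F : ℂ → ℂ, AnalyticAt ℂ F z₀ ∧ ∀ᶠ z in 𝓝 z₀, greenFunction P z = (F z).re := by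
  obtain ⟨R, hR, hPR⟩ := exists_escape_radius hP
  obtain ⟨H, hHd, hH⟩ := exists_greenFunction_eq_log_add_re hP hR hPR
  have hd : (2 : ℝ) ≤ P.natDegree := by exact_mod_cast hP
  obtain ⟨N, hN⟩ : ∃ N : ℕ, R < ‖(fun w => P.eval w)^[N] z₀‖ := by
    by_contra! h
    refine hz₀.ne' ((greenFunction_eq_zero_iff hP z₀).2 ?_)
    refine (Metric.isBounded_closedBall (x := (0 : ℂ)) (r := R)).subset ?_
    rintro _ ⟨n, rfl⟩
    simpa using h n
  set f := (fun w => P.eval w)^[N] with hf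
  have hfd : Differentiable ℂ f := P.differentiable.iterate N
  have hfa : AnalyticAt ℂ f z₀ := hfd.analyticAt z₀
  have hf0 : f z₀ ≠ 0 := norm_pos_iff.1 (by linarith)
  have hUo : IsOpen {z : ℂ | R < ‖z‖} := isOpen_lt continuous_const continuous_norm
  have hHa : AnalyticAt ℂ H (f z₀) := hHd.analyticAt (hUo.mem_nhds hN)
  have hfz : ∀ᶠ z in 𝓝 z₀, R < ‖f z‖ :=
    (hfd.continuous.norm.continuousAt).eventually (lt_mem_nhds hN)
  -- Division by `f z₀` moves the argument of the logarithm near 1, away from the branch cut; the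
  -- real constant restores the modulus.
  refine ⟨fun z => (((P.natDegree : ℝ) ^ N)⁻¹ : ℝ) *
    (Complex.log (f z / f z₀) + Real.log ‖f z₀‖ + H (f z)), ?_, ?_⟩
  · refine analyticAt_const.mul (AnalyticAt.add (AnalyticAt.add (AnalyticAt.clog ?_ ?_)
      analyticAt_const) (AnalyticAt.comp hHa hfa))
    · exact hfa.div_const
    · rw [div_self hf0]
      exact Complex.one_mem_slitPlane
  · filter_upwards [hfz] with z hz
    have hfz0 : f z ≠ 0 := norm_pos_iff.1 (by linarith)
    have h1 := greenFunction_iterate hP N z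
    rw [← hf, hH _ hz] at h1
    have hdN : (0 : ℝ) < (P.natDegree : ℝ) ^ N := by positivity
    rw [Complex.re_ofReal_mul, Complex.add_re, Complex.add_re, Complex.log_re,
      norm_div,
      Real.log_div (by simpa using hfz0) (by simpa using hf0), Complex.ofReal_re]
    field_simp
    linarith

end Green

/-! ### Components of regular sublevel sets -/

section Levels

variable {P : ℂ[X]}

theorem contDiffAt_greenFunction (hP : 2 ≤ P.natDegree) {z₀ : ℂ} (hz₀ : 0 < greenFunction P z₀)
    {n : WithTop ℕ∞} : ContDiffAt ℝ n (greenFunction P) z₀ := by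
  obtain ⟨F, hF, hFG⟩ := exists_analyticAt_greenFunction_eq_re hP hz₀
  refine ContDiffAt.congr_of_eventuallyEq ?_ hFG
  exact Complex.reCLM.contDiff.contDiffAt.comp z₀ (hF.contDiffAt.restrict_scalars ℝ)

/-- The Green function takes at most one critical value near each point. -/
theorem eventually_greenFunction_eq_of_critical (hP : 2 ≤ P.natDegree) {z₀ : ℂ}
    (hz₀ : 0 < greenFunction P z₀) :
    ∀ᶠ z in 𝓝 z₀, fderiv ℝ (greenFunction P) z = 0 → greenFunction P z = greenFunction P z₀ := by
  obtain ⟨F, hF, hFG⟩ := exists_analyticAt_greenFunction_eq_re hP hz₀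
  have hcrit : ∀ᶠ z in 𝓝 z₀, fderiv ℝ (greenFunction P) z = 0 → deriv F z = 0 := by
    filter_upwards [hFG.eventually_nhds, hF.eventually_analyticAt] with z hz hFz h0
    have h1 : HasFDerivAt (greenFunction P)
        (Complex.reCLM.comp ((fderiv ℂ F z).restrictScalars ℝ)) z :=
      (Complex.reCLM.hasFDerivAt.comp z
        (hFz.differentiableAt.hasFDerivAt.restrictScalars ℝ)).congr_of_eventuallyEq hz
    rw [h1.fderiv] at h0
    have e1 := congrArg (fun L : ℂ →L[ℝ] ℝ => L 1) h0
    have e2 := congrArg (fun L : ℂ →L[ℝ] ℝ => L Complex.I) h0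
    have e3 : fderiv ℂ F z Complex.I = Complex.I * deriv F z := by
      have := (fderiv ℂ F z).map_smul Complex.I 1
      rwa [smul_eq_mul, mul_one, smul_eq_mul, fderiv_apply_one_eq_deriv] at this
    simp only [ContinuousLinearMap.comp_apply, ContinuousLinearMap.coe_restrictScalars',
      Complex.reCLM_apply, zero_apply, e3, fderiv_apply_one_eq_deriv,
      Complex.mul_re, Complex.I_re, Complex.I_im, zero_mul, one_mul, zero_sub, neg_eq_zero]
      at e1 e2
    exact Complex.ext e1 e2
  -- Either `F` is constant near `z₀`, or `F'` has no zero near `z₀` except possibly `z₀` itself.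
  rcases hF.deriv.eventually_eq_zero_or_eventually_ne_zero with h | h
  · obtain ⟨r, hr, hball⟩ := Metric.eventually_nhds_iff_ball.1
      (h.and (hF.eventually_analyticAt.and hFG))
    filter_upwards [Metric.ball_mem_nhds z₀ hr] with z hz _
    have hconst := Metric.isOpen_ball.is_const_of_deriv_eq_zero
      (convex_ball z₀ r).isPreconnected
      (fun y hy => (hball y hy).2.1.differentiableAt.differentiableWithinAt)
      (fun y hy => (hball y hy).1) hz (Metric.mem_ball_self hr)
    rw [(hball z hz).2.2, (hball z₀ (Metric.mem_ball_self hr)).2.2, hconst]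
  · rw [eventually_nhdsWithin_iff] at h
    filter_upwards [h, hcrit] with z hz hcz h0
    by_contra hne
    exact hz (fun e => hne (by rw [mem_singleton_iff.1 e])) (hcz h0)

/-- Lindelöf: countably many of the neighbourhoods with at most one critical value cover the
critical points. -/
theorem countable_critical_values (hP : 2 ≤ P.natDegree) :
    (greenFunction P '' {z | 0 < greenFunction P z ∧
      fderiv ℝ (greenFunction P) z = 0}).Countable := by
  set A := {z | 0 < greenFunction P z ∧ fderiv ℝ (greenFunction P) z = 0}
  obtain ⟨t, -, htc, ht⟩ := TopologicalSpace.countable_cover_nhdsWithin (s := A)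
    (f := fun x => {y | fderiv ℝ (greenFunction P) y = 0 → greenFunction P y = greenFunction P x})
    fun x hx => mem_nhdsWithin_of_mem_nhds (eventually_greenFunction_eq_of_critical hP hx.1)
  refine (htc.image (greenFunction P)).mono ?_
  rintro _ ⟨y, hy, rfl⟩
  obtain ⟨x, hxt, hx⟩ := mem_iUnion₂.1 (ht hy)
  exact ⟨x, hxt, (hx hy.2).symm⟩

/-- The Green function is locally constant at its local maxima off the filled Julia set. -/
theorem eventually_eq_of_isLocalMax_greenFunction (hP : 2 ≤ P.natDegree) {z₀ : ℂ}
    (hz₀ : 0 < greenFunction P z₀) (hmax : IsLocalMax (greenFunction P) z₀) :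
    ∀ᶠ z in 𝓝 z₀, greenFunction P z = greenFunction P z₀ := by
  obtain ⟨F, hF, hFG⟩ := exists_analyticAt_greenFunction_eq_re hP hz₀
  have hF0 := hFG.self_of_nhds
  rcases hF.eventually_constant_or_nhds_le_map_nhds with h | h
  · filter_upwards [h, hFG] with z h1 h2
    rw [h2, h1, hF0]
  · exfalso
    have h1 : ∀ᶠ z in 𝓝 z₀, (F z).re ≤ (F z₀).re := by
      filter_upwards [hmax, hFG] with z h1 h2
      rwa [← h2, ← hF0]
    have h2 : ∀ᶠ w in 𝓝 (F z₀), w.re ≤ (F z₀).re := h h1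
    have h3 : Tendsto (fun t : ℝ => F z₀ + t) (𝓝[>] 0) (𝓝 (F z₀)) := by
      have : Tendsto (fun t : ℝ => F z₀ + t) (𝓝 0) (𝓝 (F z₀ + (0 : ℝ))) :=
        (by fun_prop : Continuous fun t : ℝ => F z₀ + t).tendsto 0
      rw [Complex.ofReal_zero, add_zero] at this
      exact this.mono_left nhdsWithin_le_nhds
    obtain ⟨t, ht, ht0⟩ := ((h3.eventually h2).and self_mem_nhdsWithin).exists
    have ht0 : (0 : ℝ) < t := ht0
    rw [Complex.add_re, Complex.ofReal_re] at ht
    linarith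

/-- The component containing `c` of the sublevel set `{G < s}` of the Green function. -/
noncomputable def greenComponent (P : ℂ[X]) (s : ℝ) (c : ℂ) : Set ℂ :=
  connectedComponentIn {z | greenFunction P z < s} c

/-- `s` is a regular value of the Green function. -/
def IsGreenRegular (P : ℂ[X]) (s : ℝ) : Prop :=
  ∀ z, greenFunction P z = s → fderiv ℝ (greenFunction P) z ≠ 0

theorem isOpen_sublevel (hP : 2 ≤ P.natDegree) (s : ℝ) : IsOpen {z | greenFunction P z < s} :=
  isOpen_lt (continuous_greenFunction hP) continuous_const

theorem isOpen_greenComponent (hP : 2 ≤ P.natDegree) (s : ℝ) (c : ℂ) :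
    IsOpen (greenComponent P s c) :=
  (isOpen_sublevel hP s).connectedComponentIn

theorem greenComponent_subset (s : ℝ) (c : ℂ) :
    greenComponent P s c ⊆ {z | greenFunction P z < s} :=
  connectedComponentIn_subset _ _

theorem isPreconnected_greenComponent (s : ℝ) (c : ℂ) : IsPreconnected (greenComponent P s c) :=
  isPreconnected_connectedComponentIn

theorem mem_greenComponent_self {s : ℝ} {c : ℂ} (hc : greenFunction P c < s) :
    c ∈ greenComponent P s c :=
  mem_connectedComponentIn hc

theorem subset_greenComponent {s : ℝ} {c z : ℂ} {T : Set ℂ} (hT : IsPreconnected T)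
    (hTs : ∀ w ∈ T, greenFunction P w < s) (hz : z ∈ T) (hzc : z ∈ greenComponent P s c) :
    T ⊆ greenComponent P s c := by
  have := hT.subset_connectedComponentIn (F := {w | greenFunction P w < s}) hz hTs
  rwa [← connectedComponentIn_eq hzc] at this

theorem le_of_mem_closure_greenComponent (hP : 2 ≤ P.natDegree) {s : ℝ} {c z : ℂ}
    (hz : z ∈ closure (greenComponent P s c)) : greenFunction P z ≤ s :=
  closure_minimal (fun w hw => (greenComponent_subset s c hw : greenFunction P w < s).le)
    (isClosed_le (continuous_greenFunction hP) continuous_const) hz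

/-- Adjoining a point of its closure keeps a connected set connected. -/
theorem mem_greenComponent_of_mem_closure {s : ℝ} {c z : ℂ}
    (hz : z ∈ closure (greenComponent P s c)) (hzs : greenFunction P z < s) :
    z ∈ greenComponent P s c := by
  obtain ⟨w, hw⟩ := closure_nonempty_iff.1 ⟨z, hz⟩
  exact subset_greenComponent
    ((isPreconnected_greenComponent s c).subset_closure (subset_insert z _)
      (insert_subset hz subset_closure))
    (fun y hy => hy.elim (fun e => e ▸ hzs) fun h => greenComponent_subset s c h)
    (mem_insert_of_mem z hw) hw (mem_insert z _)

theorem isBounded_greenComponent (hP : 2 ≤ P.natDegree) (s : ℝ) (c : ℂ) :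
    Bornology.IsBounded (greenComponent P s c) :=
  (isBounded_greenFunction_le hP s).subset fun z hz =>
    (show greenFunction P z ≤ s from
      (show greenFunction P z < s from greenComponent_subset s c hz).le)

theorem isCompact_closure_greenComponent (hP : 2 ≤ P.natDegree) (s : ℝ) (c : ℂ) :
    IsCompact (closure (greenComponent P s c)) :=
  (isBounded_greenComponent hP s c).isCompact_closure

/-- A function decreases along a fixed direction near a noncritical point. -/
theorem exists_forall_lt_of_hasStrictFDerivAt {g : ℂ → ℝ} {L : ℂ →L[ℝ] ℝ} {x : ℂ}
    (hg : HasStrictFDerivAt g L x) (hL : L ≠ 0) :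
    ∃ (v : ℂ) (r : ℝ), 0 < r ∧ ∀ y ∈ Metric.ball x r, ∀ t ∈ Ioo 0 r, g (y - t * v) < g y := by
  obtain ⟨v, hv⟩ : ∃ v, 0 < L v := by
    by_contra! h
    refine hL (ContinuousLinearMap.ext fun w => le_antisymm (h w) ?_)
    have := h (-w)
    rw [map_neg] at this
    simpa using this
  have hv0 : 0 < ‖v‖ := norm_pos_iff.2 (by rintro rfl; simp at hv)
  -- With this constant the error is at most half of the main term `t * L v`; strictness gives it
  -- uniformly in the base point.
  have h1 := (hasStrictFDerivAt_iff_isLittleO.1 hg).def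
    (show 0 < L v / (2 * ‖v‖) by positivity)
  have hc : Continuous fun p : ℂ × ℝ => (p.1, p.1 - p.2 * v) := by fun_prop
  have h2 : Tendsto (fun p : ℂ × ℝ => (p.1, p.1 - p.2 * v)) (𝓝 (x, 0)) (𝓝 (x, x)) := by
    have := hc.tendsto (x, 0)
    simpa using this
  obtain ⟨r, hr, hball⟩ := Metric.eventually_nhds_iff_ball.1 (h2.eventually h1)
  refine ⟨v, r, hr, fun y hy t ht => ?_⟩
  have h3 := hball (y, t) (by
    rw [← ball_prod_same]
    refine ⟨hy, ?_⟩
    rw [Metric.mem_ball, Real.dist_eq, sub_zero, abs_of_pos ht.1]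
    exact ht.2)
  have e : L ((t : ℂ) * v) = t * L v := by
    rw [← Complex.real_smul, map_smul, smul_eq_mul]
  simp only [sub_sub_cancel, e] at h3
  rw [norm_mul, Complex.norm_real, Real.norm_of_nonneg ht.1.le, Real.norm_eq_abs] at h3
  have h4 : L v / (2 * ‖v‖) * (t * ‖v‖) = t * L v / 2 := by field_simp
  rw [h4] at h3
  have h5 := (abs_le.1 h3).1
  have h6 : 0 < t * L v := mul_pos ht.1 hv
  linarith

/-- At a regular level, a component of the sublevel set coincides locally, near each point of its
closure, with the full sublevel set. -/
theorem eventually_mem_greenComponent_iff (hP : 2 ≤ P.natDegree) {s : ℝ} (hs : 0 < s)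
    (hreg : IsGreenRegular P s) {c x : ℂ} (hx : x ∈ closure (greenComponent P s c)) :
    ∀ᶠ z in 𝓝 x, (z ∈ greenComponent P s c ↔ greenFunction P z < s) ∧
      (z ∈ closure (greenComponent P s c) ↔ greenFunction P z ≤ s) := by
  rcases (le_of_mem_closure_greenComponent hP hx).lt_or_eq with hlt | heq
  · have hxD := mem_greenComponent_of_mem_closure hx hlt
    filter_upwards [(isOpen_greenComponent hP s c).mem_nhds hxD] with z hz
    have h1 : greenFunction P z < s := greenComponent_subset s c hz
    exact ⟨⟨fun _ => h1, fun _ => hz⟩, ⟨fun _ => h1.le, fun _ => subset_closure hz⟩⟩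
  · have hcd := contDiffAt_greenFunction hP (n := 1) (hs.trans_eq heq.symm)
    obtain ⟨v, r, hr, hdec⟩ := exists_forall_lt_of_hasStrictFDerivAt
      (hcd.hasStrictFDerivAt one_ne_zero) (hreg x heq)
    set t₀ := r / 2 with ht₀
    have ht₀r : t₀ ∈ Ioo 0 r := ⟨by positivity, by linarith⟩
    have hb0 : greenFunction P (x - t₀ * v) < s := by
      rw [← heq]
      exact hdec x (Metric.mem_ball_self hr) t₀ ht₀r
    obtain ⟨δ', hδ', hball'⟩ := Metric.isOpen_iff.1 (isOpen_sublevel hP s) _ hb0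
    set δ := min δ' r with hδ
    have hδ0 : 0 < δ := lt_min hδ' hr
    have hballr : Metric.ball x δ ⊆ Metric.ball x r := Metric.ball_subset_ball (min_le_right _ _)
    set W := Metric.ball (x - t₀ * v) δ
    have hW : ∀ w ∈ W, greenFunction P w < s := fun w hw =>
      hball' (Metric.ball_subset_ball (min_le_left _ _) hw)
    have hWpre : IsPreconnected W := (convex_ball _ _).isPreconnected
    -- Descending along `v` joins every point of the sublevel set near `x` to the one disc `W`.
    -- Hence all of them are in the same component, which is that of `c` because `x` is in its
    -- closure.
    let E : ℂ → Set ℂ := fun y => (fun t : ℝ => y - t * v) '' Icc 0 t₀ ∪ W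
    have hmemE : ∀ y, y ∈ E y := fun y => Or.inl ⟨0, ⟨le_rfl, ht₀r.1.le⟩, by simp⟩
    have hE : ∀ y ∈ Metric.ball x δ, IsPreconnected (E y) := by
      intro y hy
      refine IsPreconnected.union (y - t₀ * v) ⟨t₀, ⟨ht₀r.1.le, le_rfl⟩, rfl⟩ ?_
        (isPreconnected_Icc.image _ (by fun_prop)) hWpre
      rw [Metric.mem_ball] at hy ⊢
      rwa [dist_sub_right]
    have hEs : ∀ y ∈ Metric.ball x δ, greenFunction P y < s → ∀ w ∈ E y, greenFunction P w < s := by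
      rintro y hy hys w (⟨t, ht, rfl⟩ | hw)
      · rcases ht.1.eq_or_lt with h0 | h0
        · simpa [← h0] using hys
        · exact (hdec y (hballr hy) t ⟨h0, ht.2.trans_lt ht₀r.2⟩).trans hys
      · exact hW w hw
    have hWD : W ⊆ greenComponent P s c := by
      obtain ⟨y₀, hy₀, hy₀D⟩ := mem_closure_iff.1 hx _ Metric.isOpen_ball (Metric.mem_ball_self hδ0)
      exact subset_union_right.trans (subset_greenComponent (hE y₀ hy₀)
        (hEs y₀ hy₀ (greenComponent_subset s c hy₀D)) (hmemE y₀) hy₀D)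
    have hmem : ∀ y ∈ Metric.ball x δ, greenFunction P y < s → y ∈ greenComponent P s c := by
      intro y hy hys
      have hWne : x - t₀ * v ∈ W := Metric.mem_ball_self hδ0
      exact subset_greenComponent (hE y hy) (hEs y hy hys) (Or.inr hWne) (hWD hWne) (hmemE y)
    filter_upwards [Metric.ball_mem_nhds x hδ0] with y hy
    refine ⟨⟨fun h => greenComponent_subset s c h, hmem y hy⟩,
      ⟨le_of_mem_closure_greenComponent hP, fun hys => ?_⟩⟩
    have ht : Tendsto (fun t : ℝ => y - t * v) (𝓝[>] 0) (𝓝 y) := by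
      have : Tendsto (fun t : ℝ => y - t * v) (𝓝 0) (𝓝 (y - (0 : ℝ) * v)) :=
        (by fun_prop : Continuous fun t : ℝ => y - t * v).tendsto 0
      rw [Complex.ofReal_zero, zero_mul, sub_zero] at this
      exact this.mono_left nhdsWithin_le_nhds
    refine mem_closure_of_tendsto ht ?_
    filter_upwards [ht.eventually (Metric.isOpen_ball.mem_nhds hy), Ioo_mem_nhdsGT hr] with t h1 h2
    exact hmem _ h1 ((hdec y (hballr hy) t h2).trans_le hys)

theorem hasSmoothBoundary_greenComponent (hP : 2 ≤ P.natDegree) {s : ℝ} (hs : 0 < s)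
    (hreg : IsGreenRegular P s) (c : ℂ) : HasSmoothBoundary (greenComponent P s c) := by
  intro p hp
  have hpc : p ∈ closure (greenComponent P s c) := frontier_subset_closure hp
  have hps : greenFunction P p = s := by
    refine (le_of_mem_closure_greenComponent hP hpc).antisymm (not_lt.1 fun h => ?_)
    rw [(isOpen_greenComponent hP s c).frontier_eq] at hp
    exact hp.2 (mem_greenComponent_of_mem_closure hpc h)
  have hcd : ContDiffAt ℝ ∞ (greenFunction P) p :=
    contDiffAt_greenFunction hP (hs.trans_eq hps.symm)
  have hfc : ContinuousAt (fderiv ℝ (greenFunction P)) p :=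
    (hcd.fderiv_right (m := 0) (by simp)).continuousAt
  obtain ⟨U, hU, hUo, hpU⟩ := eventually_nhds_iff.1
    ((eventually_mem_greenComponent_iff hP hs hreg hpc).and
      ((hfc.eventually_ne (hreg p hps)).and
        ((continuous_greenFunction hP).continuousAt.eventually
          (lt_mem_nhds (hs.trans_eq hps.symm)))))
  refine ⟨U, fun z => greenFunction P z - s, hUo, hpU, fun z hz => ?_, fun z hz => ?_, ?_⟩
  · exact ((contDiffAt_greenFunction hP (hU z hz).2.2).sub contDiffAt_const).contDiffWithinAt
  · rw [fderiv_sub_const]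
    exact (hU z hz).2.1
  · ext z
    simp only [mem_inter_iff, mem_ofPred_eq, sub_neg]
    exact ⟨fun h => ⟨h.2, (hU z h.2).1.1.1 h.1⟩, fun h => ⟨(hU z h.1).1.1.2 h.2, h.1⟩⟩

theorem eq_empty_of_isCompact_of_isOpen {K : Set ℂ} (hK : IsCompact K) (hKo : IsOpen K) :
    K = ∅ :=
  (isClopen_iff.1 ⟨hK.isClosed, hKo⟩).resolve_right hK.ne_univ

/-- Maximum principle: components of regular sublevel sets of the Green function have no holes. -/
theorem greenComponent_no_holes (hP : 2 ≤ P.natDegree) {s : ℝ} (hs : 0 < s)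
    (hreg : IsGreenRegular P s) (c : ℂ) (K : Set ℂ) (hK : IsCompact K)
    (hdisj : Disjoint K (greenComponent P s c)) (hopen : IsOpen (greenComponent P s c ∪ K)) :
    K = ∅ := by
  set D := greenComponent P s c with hD
  rcases K.eq_empty_or_nonempty with rfl | hKne
  · rfl
  have hZ : IsCompact (closure D ∪ K) := (isCompact_closure_greenComponent hP s c).union hK
  obtain ⟨z, hzZ, hzmax⟩ := hZ.exists_isMaxOn (hKne.mono subset_union_right)
    (continuous_greenFunction hP).continuousOn
  have hVZ : D ∪ K ⊆ closure D ∪ K := union_subset_union_left _ subset_closure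
  have hlocmax : ∀ y ∈ D ∪ K, greenFunction P y = greenFunction P z →
      IsLocalMax (greenFunction P) y := by
    intro y hy hyz
    filter_upwards [hopen.mem_nhds hy] with w hw
    rw [hyz]
    exact hzmax (hVZ hw)
  -- If the maximum of `G` exceeds `s`, it is attained only in `K`. The set where it is attained is
  -- compact, and open because `G` is locally constant at its maxima; no nonempty plane set is both.
  rcases lt_or_ge s (greenFunction P z) with hsz | hsz
  · exfalso
    set A := (closure D ∪ K) ∩ {y | greenFunction P y = greenFunction P z} with hA
    have hAV : A ⊆ D ∪ K := by
      rintro y ⟨h1 | h1, h2⟩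
      · exact absurd (le_of_mem_closure_greenComponent hP h1)
          (not_le.2 (hsz.trans_eq (h2 : greenFunction P y = _).symm))
      · exact Or.inr h1
    have hAc : IsCompact A :=
      hZ.inter_right (isClosed_eq (continuous_greenFunction hP) continuous_const)
    have hAo : IsOpen A := by
      rw [isOpen_iff_mem_nhds]
      intro y hy
      have hyz : greenFunction P y = greenFunction P z := hy.2
      filter_upwards [hopen.mem_nhds (hAV hy), eventually_eq_of_isLocalMax_greenFunction hP
        (hs.trans (hsz.trans_eq hyz.symm)) (hlocmax y (hAV hy) hyz)] with w hw1 hw2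
      exact ⟨hVZ hw1, hw2.trans hyz⟩
    have : z ∈ A := ⟨hzZ, rfl⟩
    rw [eq_empty_of_isCompact_of_isOpen hAc hAo] at this
    exact this
  -- Otherwise a point of level `s` in `D ∪ K` would be a local maximum, against regularity. So `G <
  -- s` there, `K` misses `closure D`, and `K` is open as well as compact.
  · refine eq_empty_of_isCompact_of_isOpen hK ?_
    have hlt : ∀ y ∈ D ∪ K, greenFunction P y < s := by
      intro y hy
      have hyz : greenFunction P y ≤ greenFunction P z := hzmax (hVZ hy)
      refine (hyz.trans hsz).lt_of_ne fun h => ?_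
      exact hreg y h (hlocmax y hy (by linarith)).fderiv_eq_zero
    have : K = (D ∪ K) ∩ (closure D)ᶜ := by
      ext y
      constructor
      · intro hy
        refine ⟨Or.inr hy, fun hyc => ?_⟩
        exact Set.disjoint_left.1 hdisj hy
          (mem_greenComponent_of_mem_closure hyc (hlt y (Or.inr hy)))
      · rintro ⟨hy | hy, hyc⟩
        · exact absurd (subset_closure hy) hyc
        · exact hy
    rw [this]
    exact hopen.inter isClosed_closure.isOpen_compl

theorem isSmoothDisc_greenComponent (hP : 2 ≤ P.natDegree) {s : ℝ} (hs : 0 < s)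
    (hreg : IsGreenRegular P s) {c : ℂ} (hc : greenFunction P c < s) :
    IsSmoothDisc (greenComponent P s c) where
  isOpen := isOpen_greenComponent hP s c
  isBounded := isBounded_greenComponent hP s c
  isSimplyConnected := isSimplyConnected_of_no_holes (isOpen_greenComponent hP s c)
    (isBounded_greenComponent hP s c)
    ⟨⟨c, mem_greenComponent_self hc⟩, isPreconnected_greenComponent s c⟩
    (greenComponent_no_holes hP hs hreg c)
  hasSmoothBoundary := hasSmoothBoundary_greenComponent hP hs hreg c

end Levels

/-! ### Connectedness and fibres of coverings -/

section Topology

/-- A punctured disc is connected. -/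
theorem isPreconnected_ball_diff_center (p : ℂ) (r : ℝ) :
    IsPreconnected (Metric.ball p r \ {p}) := by
  have h : Metric.ball p r \ {p} =
      (fun x : ℝ × ℝ => p + x.1 * Complex.exp (x.2 * Complex.I)) '' (Ioo 0 r ×ˢ univ) := by
    ext z
    constructor
    · rintro ⟨hz, hzp⟩
      refine ⟨(‖z - p‖, (z - p).arg), ⟨⟨norm_pos_iff.2 (sub_ne_zero.2 hzp), ?_⟩, mem_univ _⟩, ?_⟩
      · rwa [mem_ball_iff_norm] at hz
      · simp only [Complex.norm_mul_exp_arg_mul_I]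
        ring
    · rintro ⟨⟨ρ, θ⟩, ⟨⟨h1, h2⟩, -⟩, rfl⟩
      have hn : ‖(ρ : ℂ) * Complex.exp (θ * Complex.I)‖ = ρ := by
        rw [norm_mul, Complex.norm_exp_ofReal_mul_I, mul_one, Complex.norm_real,
          Real.norm_of_nonneg h1.le]
      refine ⟨?_, ?_⟩
      · rw [mem_ball_iff_norm, add_sub_cancel_left, hn]
        exact h2
      · intro h
        have h3 : (ρ : ℂ) * Complex.exp (θ * Complex.I) = 0 := by simpa using h
        rw [h3, norm_zero] at hn
        simp only at h1
        linarith
  rw [h]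
  exact (isPreconnected_Ioo.prod isPreconnected_univ).image _ (by fun_prop)

/-- A small punctured disc about `p` is connected, so it lies on one side of any separation of `D \
{p}`; filling in `p` on that side would separate `D`. -/
theorem IsPreconnected.diff_singleton_of_isOpen {D : Set ℂ} (hD : IsPreconnected D)
    (ho : IsOpen D) (p : ℂ) : IsPreconnected (D \ {p}) := by
  by_cases hp : p ∈ D
  swap
  · rwa [sdiff_singleton_eq_self hp]
  obtain ⟨r, hr, hball⟩ := Metric.isOpen_iff.1 ho p hp
  have key : ∀ u v : Set ℂ, IsOpen u → IsOpen v → D \ {p} ⊆ u ∪ v → (D \ {p} ∩ v).Nonempty →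
      Metric.ball p r \ {p} ⊆ u → (D \ {p} ∩ (u ∩ v)).Nonempty := by
    rintro u v hu hv hsub ⟨x, ⟨hxD, hxp⟩, hxv⟩ hbu
    obtain ⟨y, hyD, hyu, hyv, hyp⟩ := hD (u ∪ Metric.ball p r) (v \ {p})
      (hu.union Metric.isOpen_ball) (hv.sdiff (isClosed_singleton)) (by
        intro y hy
        by_cases hyp : y = p
        · exact Or.inl (Or.inr (hyp ▸ Metric.mem_ball_self hr))
        · rcases hsub ⟨hy, hyp⟩ with h | h
          · exact Or.inl (Or.inl h)
          · exact Or.inr ⟨h, hyp⟩)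
      ⟨p, hp, Or.inr (Metric.mem_ball_self hr)⟩ ⟨x, hxD, hxv, hxp⟩
    exact ⟨y, ⟨hyD, hyp⟩, hyu.elim id fun h => hbu ⟨h, hyp⟩, hyv⟩
  intro u v hu hv hsub hun hvn
  by_contra hcon
  have hbsub : Metric.ball p r \ {p} ⊆ D \ {p} := sdiff_subset_sdiff_left hball
  have hbu : (Metric.ball p r \ {p} ∩ u).Nonempty → Metric.ball p r \ {p} ⊆ u := by
    intro hne y hy
    rcases hsub (hbsub hy) with h | h
    · exact h
    · exfalso
      obtain ⟨z, hz, hz'⟩ := isPreconnected_ball_diff_center p r u v hu hv (hbsub.trans hsub) hne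
        ⟨y, hy, h⟩
      exact hcon ⟨z, hbsub hz, hz'⟩
  by_cases hne : (Metric.ball p r \ {p} ∩ u).Nonempty
  · exact hcon (key u v hu hv hsub hvn (hbu hne))
  · have hbv : Metric.ball p r \ {p} ⊆ v := fun y hy =>
      (hsub (hbsub hy)).resolve_left fun h => hne ⟨y, hy, h⟩
    rw [inter_comm u v] at hcon
    rw [union_comm] at hsub
    exact hcon (key v u hv hu hsub hun hbv)

theorem IsPreconnected.diff_finite_of_isOpen {D F : Set ℂ} (hD : IsPreconnected D)
    (ho : IsOpen D) (hF : F.Finite) : IsPreconnected (D \ F) := by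
  induction F, hF using Set.Finite.induction_on with
  | empty => rwa [sdiff_empty]
  | @insert a s _ hs ih =>
    have : D \ insert a s = (D \ s) \ {a} := by
      ext x
      simp only [Set.mem_sdiff, mem_insert_iff, mem_singleton_iff]
      tauto
    rw [this]
    exact ih.diff_singleton_of_isOpen (ho.sdiff hs.isClosed) a

theorem subset_closure_diff_finite {D F : Set ℂ} (ho : IsOpen D) (hF : F.Finite) :
    D ⊆ closure (D \ F) :=
  (hF.countable.dense_compl ℂ).open_subset_closure_inter ho

theorem IsPreconnected.closure_diff_finite_of_isOpen {D F : Set ℂ} (hD : IsPreconnected D)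
    (ho : IsOpen D) (hF : F.Finite) : IsPreconnected (closure D \ F) :=
  (hD.diff_finite_of_isOpen ho hF).subset_closure (sdiff_subset_sdiff_left subset_closure)
    (sdiff_subset.trans (closure_minimal (subset_closure_diff_finite ho hF) isClosed_closure))

/-- The intersection of a decreasing sequence of compact connected sets is connected. -/
theorem isPreconnected_iInter_of_antitone {K : ℕ → Set ℂ} (hK : ∀ n, IsCompact (K n))
    (hpre : ∀ n, IsPreconnected (K n)) (hanti : Antitone K) : IsPreconnected (⋂ n, K n) := by
  have hc : IsCompact (⋂ n, K n) := (hK 0).of_isClosed_subset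
    (isClosed_iInter fun n => (hK n).isClosed) (iInter_subset K 0)
  rw [isPreconnected_iff_subset_of_fully_disjoint_closed hc.isClosed]
  intro u v hu hv hsub hdisj
  obtain ⟨U, V, hU, hV, huU, hvV, hUV⟩ := SeparatedNhds.of_isCompact_isCompact (hc.inter_right hu)
    (hc.inter_right hv) (hdisj.mono inter_subset_right inter_subset_right)
  obtain ⟨n, hn⟩ := exists_subset_nhds_of_isCompact (V := K)
    (directed_of_isDirected_le fun _ _ h => hanti h) hK (U := U ∪ V) (fun x hx =>
      (hU.union hV).mem_nhds ((hsub hx).imp (fun h => huU ⟨hx, h⟩) fun h => hvV ⟨hx, h⟩))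
  rcases IsPreconnected.subset_or_subset hU hV hUV hn (hpre n) with h | h
  · refine Or.inl fun x hx => (hsub hx).resolve_right fun hxv => ?_
    exact Set.disjoint_left.1 hUV (h (mem_iInter.1 hx n)) (hvV ⟨hx, hxv⟩)
  · refine Or.inr fun x hx => (hsub hx).resolve_left fun hxu => ?_
    exact Set.disjoint_left.1 hUV (huU ⟨hx, hxu⟩) (h (mem_iInter.1 hx n))

/-- The number of sheets of a covering map is locally constant. -/
theorem IsCoveringMapOn.eventually_card_fiber_eq {E X : Type*} [TopologicalSpace E]
    [TopologicalSpace X] {f : E → X} {A : Set X} (hf : IsCoveringMapOn f A) {x : X} (hx : x ∈ A) :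
    ∀ᶠ y in 𝓝 x, Nat.card (f ⁻¹' {y}) = Nat.card (f ⁻¹' {x}) := by
  obtain ⟨dt, U, hxU, hU, hfU, H, hH⟩ := hf x hx
  filter_upwards [hU.mem_nhds hxU] with y hy
  have hev : IsEvenlyCovered f y (f ⁻¹' {x}) := ⟨dt, U, hy, hU, hfU, H, hH⟩
  exact (Nat.card_congr hev.fiberHomeomorph.toEquiv).symm

/-- The restriction `S → T` of an open map is a local homeomorphism near the points where it is
locally injective and where `S` is locally the full preimage of `T`. -/
theorem isLocalHomeomorphOn_restrict {f : ℂ → ℂ} {S T : Set ℂ} (h : MapsTo f S T)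
    (hf : Continuous f) (hopen : IsOpenMap f) (A : Set S)
    (hloc : ∀ x ∈ A, ∃ V : Set ℂ, IsOpen V ∧ (x : ℂ) ∈ V ∧ InjOn f V ∧
      ∀ z ∈ V, f z ∈ T → z ∈ S) :
    IsLocalHomeomorphOn (h.restrict f S T) A := by
  rw [isLocalHomeomorphOn_iff_isOpenEmbedding_restrict]
  intro x hx
  obtain ⟨V, hV, hxV, hinj, hback⟩ := hloc x hx
  have hfc : Continuous (h.restrict f S T) := hf.continuousOn.mapsToRestrict h
  refine ⟨Subtype.val ⁻¹' V, (hV.preimage continuous_subtype_val).mem_nhds hxV,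
    IsOpenEmbedding.of_continuous_injective_isOpenMap ?_ ?_ ?_⟩
  · exact hfc.comp continuous_subtype_val
  · intro a b hab
    have : f a.1.1 = f b.1.1 := congrArg Subtype.val hab
    exact Subtype.ext (Subtype.ext (hinj a.2 b.2 this))
  · intro O hO
    obtain ⟨O₁, hO₁, rfl⟩ := isOpen_induced_iff.1 hO
    obtain ⟨O₂, hO₂, rfl⟩ := isOpen_induced_iff.1 hO₁
    have : (Subtype.val ⁻¹' V : Set S).domRestrict (h.restrict f S T) ''
        (Subtype.val ⁻¹' (Subtype.val ⁻¹' O₂)) = Subtype.val ⁻¹' (f '' (O₂ ∩ V)) := by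
      ext y
      constructor
      · rintro ⟨z, hz, rfl⟩
        exact ⟨z.1.1, ⟨hz, z.2⟩, rfl⟩
      · rintro ⟨z, ⟨hz, hzV⟩, hzy⟩
        exact ⟨⟨⟨z, hback z hzV (by rw [hzy]; exact y.2)⟩, hzV⟩, hz, Subtype.ext hzy⟩
    rw [this]
    exact (hopen _ (hO₂.inter hV)).preimage continuous_subtype_val

theorem ncard_fiber_restrict {f : ℂ → ℂ} {S T : Set ℂ} (h : MapsTo f S T) (w : T) :
    Nat.card (h.restrict f S T ⁻¹' {w}) = (S ∩ f ⁻¹' {(w : ℂ)}).ncard := by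
  rw [Nat.card_coe_set_eq, ← Set.ncard_image_of_injective _ Subtype.val_injective]
  congr 1
  ext z
  constructor
  · rintro ⟨y, hy, rfl⟩
    exact ⟨y.2, congrArg Subtype.val hy⟩
  · rintro ⟨hz, hzw⟩
    exact ⟨⟨z, hz⟩, Subtype.ext hzw, rfl⟩

/-- The number of sheets is locally constant on the connected set `T \ B`. -/
theorem exists_ncard_fiber_eq {f : ℂ → ℂ} {S T B : Set ℂ} (h : MapsTo f S T)
    (hcov : IsCoveringMapOn (h.restrict f S T) {w : T | (w : ℂ) ∉ B})
    (hpre : IsPreconnected (T \ B)) : ∃ m : ℕ, ∀ w ∈ T \ B, (S ∩ f ⁻¹' {w}).ncard = m := by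
  rcases (T \ B).eq_empty_or_nonempty with he | ⟨w₀, hw₀⟩
  · exact ⟨0, by simp [he]⟩
  refine ⟨(S ∩ f ⁻¹' {w₀}).ncard, fun w hw =>
    hpre.constant (f := fun w => (S ∩ f ⁻¹' {w}).ncard) (fun y hy => ?_) hw hw₀⟩
  have hconst : ContinuousWithinAt (fun _ => (S ∩ f ⁻¹' {y}).ncard) (T \ B) y :=
    continuousWithinAt_const
  refine hconst.congr_of_eventuallyEq ?_ rfl
  have h1 := hcov.eventually_card_fiber_eq (x := ⟨y, hy.1⟩) hy.2
  refine Filter.Eventually.filter_mono (nhdsWithin_mono y sdiff_subset) ?_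
  rw [nhdsWithin_eq_map_subtype_coe hy.1, eventually_map]
  filter_upwards [h1] with z hz
  rwa [ncard_fiber_restrict, ncard_fiber_restrict] at hz

end Topology

/-! ### Polynomials as branched coverings between sublevel components -/

section Covering

variable {P : ℂ[X]}

/-- The set of critical values of a polynomial. -/
def criticalValues (P : ℂ[X]) : Set ℂ := (fun z => P.eval z) '' {z | P.derivative.eval z = 0}

theorem finite_criticalValues (hP : 2 ≤ P.natDegree) : (criticalValues P).Finite := by
  have h0 : P.derivative ≠ 0 := by
    intro h
    have := derivative_eq_zero.1 h
    omega
  refine Set.Finite.image _ ((P.derivative.rootSet_finite ℂ).subset fun z hz => ?_)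
  rw [mem_rootSet]
  exact ⟨h0, by simpa using hz⟩

theorem finite_eval_fiber (hP : 2 ≤ P.natDegree) (w : ℂ) :
    ((fun z => P.eval z) ⁻¹' {w}).Finite := by
  have hne : P ≠ Polynomial.C w := by
    rintro h
    rw [h, natDegree_C] at hP
    omega
  rw [preimage_eval_singleton hne]
  exact rootSet_finite _ _

theorem isOpenMap_polynomial_eval (hP : 2 ≤ P.natDegree) : IsOpenMap fun z => P.eval z := by
  have ha : AnalyticOnNhd ℂ (fun z => P.eval z) univ := fun z _ => P.differentiable.analyticAt z
  rcases ha.is_constant_or_isOpen isPreconnected_univ with ⟨w, hw⟩ | h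
  · have hfin := finite_eval_fiber hP w
    have : (fun z => P.eval z) ⁻¹' {w} = univ := eq_univ_of_forall fun z => hw z (mem_univ z)
    rw [this] at hfin
    exact absurd hfin Set.infinite_univ
  · exact fun s hs => h s (subset_univ s) hs

variable {s : ℝ} {c : ℂ}

theorem greenFunction_eval_lt_iff (hP : 2 ≤ P.natDegree) {z : ℂ} :
    greenFunction P (P.eval z) < P.natDegree * s ↔ greenFunction P z < s := by
  have hd : (0 : ℝ) < P.natDegree := by
    have : 0 < P.natDegree := by omega
    exact_mod_cast this
  rw [greenFunction_eval hP, mul_lt_mul_iff_right₀ hd]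

theorem greenFunction_eval_le_iff (hP : 2 ≤ P.natDegree) {z : ℂ} :
    greenFunction P (P.eval z) ≤ P.natDegree * s ↔ greenFunction P z ≤ s := by
  have hd : (0 : ℝ) < P.natDegree := by
    have : 0 < P.natDegree := by omega
    exact_mod_cast this
  rw [greenFunction_eval hP, mul_le_mul_iff_right₀ hd]

theorem mapsTo_greenComponent (hP : 2 ≤ P.natDegree) (hc : greenFunction P c < s)
    (hPc : P.eval c ∈ greenComponent P (P.natDegree * s) c) :
    MapsTo (fun z => P.eval z) (greenComponent P s c)
      (greenComponent P (P.natDegree * s) c) := by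
  rw [mapsTo_iff_image_subset]
  refine subset_greenComponent
    ((isPreconnected_greenComponent s c).image _ P.continuous.continuousOn) ?_
    ⟨c, mem_greenComponent_self hc, rfl⟩ hPc
  rintro _ ⟨z, hz, rfl⟩
  exact (greenFunction_eval_lt_iff hP).2 (greenComponent_subset s c hz)

theorem mem_greenComponent_of_eval_mem (hP : 2 ≤ P.natDegree) {z : ℂ}
    (hz : z ∈ closure (greenComponent P s c))
    (hPz : P.eval z ∈ greenComponent P (P.natDegree * s) c) : z ∈ greenComponent P s c :=
  mem_greenComponent_of_mem_closure hz
    ((greenFunction_eval_lt_iff hP).1 (greenComponent_subset (P.natDegree * s) c hPz))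

/-- The image is open, and relatively closed in the connected target, since boundary points of the
source are mapped to the level `d * s`, outside the target. -/
theorem surjOn_greenComponent (hP : 2 ≤ P.natDegree) (hc : greenFunction P c < s)
    (hPc : P.eval c ∈ greenComponent P (P.natDegree * s) c) :
    SurjOn (fun z => P.eval z) (greenComponent P s c)
      (greenComponent P (P.natDegree * s) c) := by
  refine (isPreconnected_greenComponent _ c).subset_of_closure_inter_subset
    (isOpenMap_polynomial_eval hP _ (isOpen_greenComponent hP s c))
    ⟨_, hPc, c, mem_greenComponent_self hc, rfl⟩ ?_
  rintro w ⟨hw, hwD⟩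
  have hcl : closure ((fun z => P.eval z) '' greenComponent P s c) ⊆
      (fun z => P.eval z) '' closure (greenComponent P s c) :=
    closure_minimal (image_mono subset_closure)
      ((isCompact_closure_greenComponent hP s c).image P.continuous).isClosed
  obtain ⟨z, hz, rfl⟩ := hcl hw
  exact ⟨z, mem_greenComponent_of_eval_mem hP hz hwD, rfl⟩

/-- By regularity `closure D` is locally `{G ≤ s}`, so near its points it contains the whole
preimage of `closure D'`. Away from critical points this gives a local homeomorphism up to the
boundary, and compactness makes it a covering. By `hcv` the branch values stay off the boundary. The
count inside the open sets serves to compare different levels. -/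
theorem exists_isBranchedCovering (hP : 2 ≤ P.natDegree) (hs : 0 < s) (hreg : IsGreenRegular P s)
    (hcv : ∀ w ∈ criticalValues P, greenFunction P w ≠ P.natDegree * s)
    (hc : greenFunction P c < s) (hPc : P.eval c ∈ greenComponent P (P.natDegree * s) c) :
    ∃ m : ℕ, IsBranchedCovering (fun z => P.eval z) (closure (greenComponent P s c))
        (closure (greenComponent P (P.natDegree * s) c)) m ∧
      ∀ w ∈ greenComponent P (P.natDegree * s) c \ criticalValues P,
        (greenComponent P s c ∩ (fun z => P.eval z) ⁻¹' {w}).ncard = m := by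
  set D := greenComponent P s c with hD
  set D' := greenComponent P (P.natDegree * s) c with hD'
  have hmaps : MapsTo (fun z => P.eval z) (closure D) (closure D') :=
    (mapsTo_greenComponent hP hc hPc).closure P.continuous
  have hsurj : SurjOn (fun z => P.eval z) (closure D) (closure D') := by
    refine closure_minimal ((surjOn_greenComponent hP hc hPc).trans (image_mono subset_closure)) ?_
    exact ((isCompact_closure_greenComponent hP s c).image P.continuous).isClosed
  set B := criticalValues P ∩ closure D' with hB
  have hfin := finite_criticalValues hP
  have hBD : B ⊆ D' := fun w hw => mem_greenComponent_of_mem_closure hw.2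
    ((le_of_mem_closure_greenComponent hP hw.2).lt_of_ne (hcv w hw.1))
  have hDo := isOpen_greenComponent hP s c
  have hDo' := isOpen_greenComponent hP (P.natDegree * s) c
  have hcompact : CompactSpace (closure D) :=
    isCompact_iff_compactSpace.1 (isCompact_closure_greenComponent hP s c)
  have hcov : IsCoveringMapOn (hmaps.restrict _ _ _) {w : closure D' | (w : ℂ) ∉ B} := by
    refine IsCoveringMapOn.of_isLocalHomeomorphOn (P.continuous.continuousOn.mapsToRestrict hmaps)
      (isLocalHomeomorphOn_restrict hmaps P.continuous (isOpenMap_polynomial_eval hP) _ fun x hx => ?_)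
    have hder : P.derivative.eval (x : ℂ) ≠ 0 := fun h0 => hx ⟨⟨x, h0, rfl⟩, hmaps x.2⟩
    set e := ((P.hasStrictDerivAt (x : ℂ)).hasStrictFDerivAt_equiv hder).toOpenPartialHomeomorph _
      with he
    obtain ⟨V, hV, hVo, hxV⟩ := eventually_nhds_iff.1
      (eventually_mem_greenComponent_iff hP hs hreg x.2)
    refine ⟨V ∩ e.source, hVo.inter e.open_source, ⟨hxV, ((P.hasStrictDerivAt
      (x : ℂ)).hasStrictFDerivAt_equiv hder).mem_toOpenPartialHomeomorph_source⟩, ?_, ?_⟩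
    · exact e.injOn.mono inter_subset_right
    · intro z hz hPz
      exact (hV z hz.1).2.2 ((greenFunction_eval_le_iff hP).1 (le_of_mem_closure_greenComponent hP hPz))
  have hTB : closure D' \ B = closure D' \ criticalValues P := by
    ext w
    simp only [hB, Set.mem_sdiff, mem_inter_iff]
    tauto
  obtain ⟨m, hm⟩ := exists_ncard_fiber_eq hmaps hcov (by
    rw [hTB]
    exact (isPreconnected_greenComponent _ c).closure_diff_finite_of_isOpen hDo' hfin)
  have hpre : closure D ∩ (fun z => P.eval z) ⁻¹' B ⊆ D := fun z hz =>
    mem_greenComponent_of_eval_mem hP hz.1 (hBD hz.2)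
  refine ⟨m, ⟨P.continuous.continuousOn, hsurj, hmaps, B, hfin.subset inter_subset_left,
    hBD.trans (interior_maximal subset_closure hDo'), ?_,
    hpre.trans (interior_maximal subset_closure hDo), hcov, hm⟩, fun w hw => ?_⟩
  · refine Set.Finite.subset ?_ inter_subset_right
    exact (hfin.subset inter_subset_left).preimage' fun w _ => finite_eval_fiber hP w
  · rw [← hm w ⟨subset_closure hw.1, fun h => hw.2 h.1⟩]
    congr 1
    ext z
    constructor
    · exact fun h => ⟨subset_closure h.1, h.2⟩
    · rintro ⟨h1, h2⟩
      refine ⟨mem_greenComponent_of_eval_mem hP h1 ?_, h2⟩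
      rw [mem_preimage, mem_singleton_iff] at h2
      rw [h2]
      exact hw.1

end Covering

/-! ### Earle–Hamilton contraction -/

section Contraction

/-- Auxiliary maps of the Earle–Hamilton argument: the derivative of the iterates of `g` can be
increased by a geometric factor. -/
theorem exists_hasDerivAt_iterate_mul {U : Set ℂ} (hU : IsOpen U) {g : ℂ → ℂ}
    (hg : DifferentiableOn ℂ g U) {ε : ℝ}
    (hgU : ∀ x ∈ U, ∀ y ∈ U, g y + ε * (g y - g x) ∈ U) (hmaps : MapsTo g U U) {x : ℂ}
    (hx : x ∈ U) (n : ℕ) :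
    ∃ (H : ℂ → ℂ) (a : ℂ), HasDerivAt g^[n] a x ∧ HasDerivAt H ((1 + ε) ^ n * a) x ∧
      DifferentiableOn ℂ H U ∧ MapsTo H U U ∧ H x = g^[n] x := by
  induction n with
  | zero => exact ⟨id, 1, hasDerivAt_id x, by simpa using hasDerivAt_id x, differentiableOn_id,
      mapsTo_id U, rfl⟩
  | succ n ih =>
    obtain ⟨H, a, h1, h2, h3, h4, h5⟩ := ih
    have hxn : g^[n] x ∈ U := hmaps.iterate n hx
    have hgd : HasDerivAt g (deriv g (g^[n] x)) (g^[n] x) :=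
      (hg.differentiableAt (hU.mem_nhds hxn)).hasDerivAt
    have hgH : HasDerivAt (fun y => g (H y)) (deriv g (g^[n] x) * ((1 + ε) ^ n * a)) x := by
      rw [← h5] at hgd
      have := hgd.comp x h2
      rwa [h5] at this
    have hgHU : DifferentiableOn ℂ (fun y => g (H y)) U := hg.comp h3 h4
    -- The correction vanishes at `x`, so the value there is unchanged, while the derivative gains a
    -- factor `1 + ε`.
    refine ⟨fun y => g (H y) + ε * (g (H y) - g (g^[n] x)), deriv g (g^[n] x) * a, ?_, ?_, ?_, ?_,
      ?_⟩
    · rw [Function.iterate_succ']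
      exact hgd.comp x h1
    · have := hgH.add ((hgH.sub_const (g (g^[n] x))).const_mul (ε : ℂ))
      exact HasDerivAt.congr_deriv this (by ring)
    · exact hgHU.add ((hgHU.sub_const _).const_mul _)
    · exact fun y hy => hgU _ hxn _ (h4 hy)
    · simp only [h5, Function.iterate_succ_apply', sub_self, mul_zero, add_zero]

/-- The auxiliary map `H` takes values in the bounded set `U`, so Cauchy's estimate bounds its
derivative `(1 + ε) ^ n * (gⁿ)' x` independently of `n`. -/
theorem exists_norm_deriv_iterate_le {U : Set ℂ} (hU : IsOpen U) (hb : Bornology.IsBounded U)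
    {g : ℂ → ℂ} (hg : DifferentiableOn ℂ g U) {η : ℝ} (hη : 0 < η)
    (hgη : ∀ x ∈ U, Metric.ball (g x) η ⊆ U) :
    ∃ K q : ℝ, 0 ≤ K ∧ 0 ≤ q ∧ q < 1 ∧ ∀ x, Metric.ball x (η / 2) ⊆ U → ∀ n : ℕ,
      ‖deriv g^[n] x‖ ≤ K * q ^ n := by
  obtain ⟨r, hr⟩ := hb.subset_closedBall 0
  have hmaps : MapsTo g U U := fun x hx => hgη x hx (Metric.mem_ball_self hη)
  set R := max r 1 with hR
  have hR0 : 0 < R := lt_max_of_lt_right one_pos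
  have hUR : ∀ x ∈ U, ‖x‖ ≤ R := fun x hx => by
    have := hr hx
    rw [mem_closedBall_zero_iff] at this
    exact this.trans (le_max_left _ _)
  -- Then the perturbation is at most `ε * 2 * R = η / 2`, within the room `η` around the values of
  -- `g`.
  set ε := η / (4 * R) with hε
  have hε0 : 0 < ε := by positivity
  have hgU : ∀ x ∈ U, ∀ y ∈ U, g y + ε * (g y - g x) ∈ U := by
    intro x hx y hy
    refine hgη y hy ?_
    rw [mem_ball_iff_norm, add_sub_cancel_left, norm_mul, Complex.norm_real,
      Real.norm_of_nonneg hε0.le]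
    have h1 := norm_sub_le (g y) (g x)
    have h2 := hUR _ (hmaps hx)
    have h3 := hUR _ (hmaps hy)
    calc ε * ‖g y - g x‖ ≤ ε * (2 * R) := by gcongr; linarith
      _ = η / 2 := by rw [hε]; field_simp; ring
      _ < η := by linarith
  refine ⟨R / (η / 4), (1 + ε)⁻¹, by positivity, by positivity,
    inv_lt_one_of_one_lt₀ (by linarith), fun x hx n => ?_⟩
  have hxU : x ∈ U := hx (Metric.mem_ball_self (by positivity))
  obtain ⟨H, a, h1, h2, h3, h4, -⟩ := exists_hasDerivAt_iterate_mul hU hg hgU hmaps hxU n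
  have hsub : Metric.closedBall x (η / 4) ⊆ U :=
    (Metric.closedBall_subset_ball (by linarith)).trans hx
  have h5 := Complex.norm_deriv_le_of_forall_mem_sphere_norm_le (show 0 < η / 4 by positivity)
    (DifferentiableOn.diffContOnCl ((h3.mono hsub).mono Metric.closure_ball_subset_closedBall))
    (fun z hz => hUR _ (h4 (hsub (Metric.sphere_subset_closedBall hz))))
  rw [h2.deriv, norm_mul, norm_pow] at h5
  have e : ‖(1 : ℂ) + ε‖ = 1 + ε := by
    rw [← Complex.ofReal_one, ← Complex.ofReal_add, Complex.norm_real,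
      Real.norm_of_nonneg (by positivity)]
  rw [e] at h5
  rw [h1.deriv, inv_pow, ← div_eq_mul_inv, le_div_iff₀ (by positivity), mul_comm]
  exact h5

/-- **Earle–Hamilton**: a connected compact set that is invariant under a holomorphic map of a
bounded domain strictly into itself is an attracting fixed point. -/
theorem eq_singleton_of_image_eq {U : Set ℂ} (hU : IsOpen U) (hb : Bornology.IsBounded U)
    {g : ℂ → ℂ} (hg : DifferentiableOn ℂ g U) {η : ℝ} (hη : 0 < η)
    (hgη : ∀ x ∈ U, Metric.ball (g x) η ⊆ U) {C : Set ℂ} (hC : IsCompact C)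
    (hCc : IsConnected C) (hCU : C ⊆ U) (hgC : g '' C = C) :
    ∃ z, C = {z} ∧ g z = z ∧ ‖deriv g z‖ < 1 := by
  obtain ⟨K, q, hK, hq0, hq1, hder⟩ := exists_norm_deriv_iterate_le hU hb hg hη hgη
  have hmaps : MapsTo g U U := fun x hx => hgη x hx (Metric.mem_ball_self hη)
  have hball : ∀ x ∈ C, Metric.ball x η ⊆ U := by
    intro x hx
    rw [← hgC] at hx
    obtain ⟨y, hy, rfl⟩ := hx
    exact hgη y (hCU hy)
  have hq : Tendsto (fun n : ℕ => K * q ^ n) atTop (𝓝 0) := by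
    simpa using (tendsto_pow_atTop_nhds_zero_of_lt_one hq0 hq1).const_mul K
  have hitd : ∀ n : ℕ, DifferentiableOn ℂ g^[n] U := fun n => by
    induction n with
    | zero => exact differentiableOn_id
    | succ n ih =>
      rw [Function.iterate_succ']
      exact hg.comp ih (hmaps.iterate n)
  have hlip : ∀ x ∈ C, ∀ y ∈ Metric.ball x (η / 2), ∀ n : ℕ,
      ‖g^[n] y - g^[n] x‖ ≤ K * q ^ n * (η / 2) := by
    intro x hx y hy n
    have hsub : Metric.ball x (η / 2) ⊆ U :=
      (Metric.ball_subset_ball (by linarith)).trans (hball x hx)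
    have h1 := (convex_ball x (η / 2)).norm_image_sub_le_of_norm_deriv_le (f := g^[n])
      (C := K * q ^ n)
      (fun z hz => (hitd n).differentiableAt (hU.mem_nhds (hsub hz)))
      (fun z hz => hder z (by
        refine subset_trans (fun w hw => ?_) (hball x hx)
        rw [Metric.mem_ball] at *
        linarith [dist_triangle w z x]) n) (Metric.mem_ball_self (by positivity)) hy
    rw [mem_ball_iff_norm] at hy
    exact h1.trans (by gcongr)
  -- Having asymptotic orbits is an equivalence relation that holds between nearby points, hence on
  -- all of the connected set `C`.
  have hclass : ∀ x ∈ C, ∀ y ∈ C, Tendsto (fun n => g^[n] y - g^[n] x) atTop (𝓝 0) := by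
    intro x hx y hy
    refine hCc.isPreconnected.induction₂
      (fun x y => Tendsto (fun n => g^[n] y - g^[n] x) atTop (𝓝 0)) (fun x hx => ?_)
      (fun x y z _ _ _ h1 h2 => ?_) (fun x y _ _ h => ?_) hx hy
    · refine eventually_nhdsWithin_of_eventually_nhds ?_
      filter_upwards [Metric.ball_mem_nhds x (half_pos hη)] with y hy
      refine squeeze_zero_norm (hlip x hx y hy) ?_
      simpa using hq.mul_const (η / 2)
    · simpa using h2.add h1
    · simpa using h.neg
  obtain ⟨c₀, hc₀⟩ := hCc.nonempty
  obtain ⟨t, htC, ht⟩ := hC.elim_nhds_subcover (fun x => Metric.ball x (η / 2))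
    fun x _ => Metric.ball_mem_nhds x (half_pos hη)
  have hCn : ∀ n : ℕ, g^[n] '' C = C := fun n => by
    induction n with
    | zero => simp
    | succ n ih => rw [Function.iterate_succ, image_comp, hgC, ih]
  -- By compactness `gⁿ` maps `C` into a small disc for some `n`; since `gⁿ` maps `C` onto `C`, the
  -- set itself is small.
  have hunif : ∀ δ > 0, ∀ a ∈ C, ∀ b ∈ C, ‖a - b‖ ≤ δ := by
    intro δ hδ a ha b hb
    have h1 : ∀ᶠ n : ℕ in atTop, ∀ x ∈ t, ‖g^[n] x - g^[n] c₀‖ < δ / 4 := by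
      rw [Filter.eventually_all_finset]
      intro x hx
      have := (hclass c₀ hc₀ x (htC x hx)).norm
      rw [norm_zero] at this
      exact this.eventually (gt_mem_nhds (by positivity))
    have h2 : ∀ᶠ n : ℕ in atTop, K * q ^ n * (η / 2) < δ / 4 := by
      have := hq.mul_const (η / 2)
      rw [zero_mul] at this
      exact this.eventually (gt_mem_nhds (by positivity))
    obtain ⟨n, hn1, hn2⟩ := (h1.and h2).exists
    have key : ∀ a ∈ C, ‖a - g^[n] c₀‖ ≤ δ / 2 := by
      intro a ha
      rw [← hCn n] at ha
      obtain ⟨a', ha', rfl⟩ := ha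
      obtain ⟨x, hxt, hax⟩ := mem_iUnion₂.1 (ht ha')
      have h3 := hlip x (htC x hxt) a' hax n
      have h4 := hn1 x hxt
      have h5 := norm_sub_le_norm_sub_add_norm_sub (g^[n] a') (g^[n] x) (g^[n] c₀)
      linarith
    have h3 := key a ha
    have h4 := key b hb
    have h5 := norm_sub_le_norm_sub_add_norm_sub a (g^[n] c₀) b
    rw [norm_sub_rev (g^[n] c₀) b] at h5
    linarith
  have hsing : C = {c₀} := by
    refine Subset.antisymm (fun a ha => ?_) (singleton_subset_iff.2 hc₀)
    have : ‖a - c₀‖ ≤ 0 := le_of_forall_pos_le_add fun δ hδ => by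
      rw [zero_add]; exact hunif δ hδ a ha c₀ hc₀
    rw [mem_singleton_iff]
    exact sub_eq_zero.1 (norm_le_zero_iff.1 this)
  have hfix : g c₀ = c₀ := by
    have : g c₀ ∈ C := hgC ▸ mem_image_of_mem g hc₀
    rw [hsing] at this
    exact this
  refine ⟨c₀, hsing, hfix, ?_⟩
  by_contra! hge
  have hd := (hg.differentiableAt (hU.mem_nhds (hCU hc₀))).hasDerivAt
  have h1 : ∀ n : ℕ, 1 ≤ K * q ^ n := by
    intro n
    have h2 := hder c₀ ((Metric.ball_subset_ball (by linarith)).trans (hball c₀ hc₀)) n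
    rw [(hd.iterate c₀ hfix n).deriv, norm_pow] at h2
    exact (one_le_pow₀ hge).trans h2
  have := ge_of_tendsto' hq h1
  linarith

end Contraction

/-! ### Degree one and the choice of levels -/

section PolynomialLike

variable {P : ℂ[X]}

theorem closure_greenComponent_subset (hP : 2 ≤ P.natDegree) {s t : ℝ} {c : ℂ} (hst : s < t)
    (hc : greenFunction P c < s) : closure (greenComponent P s c) ⊆ greenComponent P t c :=
  subset_greenComponent (isPreconnected_greenComponent s c).closure
    (fun _ hw => (le_of_mem_closure_greenComponent hP hw).trans_lt hst)
    (subset_closure (mem_greenComponent_self hc)) (mem_greenComponent_self (hc.trans hst))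

theorem greenComponent_mono {s t : ℝ} {c : ℂ} (hst : s ≤ t) :
    greenComponent P s c ⊆ greenComponent P t c :=
  connectedComponentIn_mono c fun _ hw => lt_of_lt_of_le hw hst

theorem nonempty_diff_finite {D F : Set ℂ} (ho : IsOpen D) (hne : D.Nonempty) (hF : F.Finite) :
    (D \ F).Nonempty :=
  closure_nonempty_iff.1 (hne.mono (subset_closure_diff_finite ho hF))

/-- If generic points of the target have one preimage, then the polynomial is injective. -/
theorem injOn_of_ncard_fiber_eq_one (hP : 2 ≤ P.natDegree) {D D' : Set ℂ} (hD : IsOpen D)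
    (hmaps : MapsTo (fun z => P.eval z) D D')
    (hfib : ∀ w ∈ D' \ criticalValues P, (D ∩ (fun z => P.eval z) ⁻¹' {w}).ncard = 1) :
    InjOn (fun z => P.eval z) D := by
  intro a ha b hb hab
  by_contra hne
  obtain ⟨A, B, hA, hB, haA, hbB, hAB⟩ := t2_separation hne
  have hopen := isOpenMap_polynomial_eval hP
  -- Disjoint neighbourhoods of `a` and `b` have overlapping open images, so some noncritical value
  -- has two preimages.
  obtain ⟨w, ⟨⟨a', ha', haw⟩, ⟨b', hb', hbw⟩⟩, hw⟩ := nonempty_diff_finite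
    ((hopen _ (hD.inter hA)).inter (hopen _ (hD.inter hB)))
    ⟨P.eval a, ⟨a, ⟨ha, haA⟩, rfl⟩, ⟨b, ⟨hb, hbB⟩, hab.symm⟩⟩ (finite_criticalValues hP)
  have hwD : w ∈ D' := haw ▸ hmaps ha'.1
  obtain ⟨x, hx⟩ := Set.ncard_eq_one.1 (hfib w ⟨hwD, hw⟩)
  have h1 : a' ∈ ({x} : Set ℂ) := hx ▸ ⟨ha'.1, haw⟩
  have h2 : b' ∈ ({x} : Set ℂ) := hx ▸ ⟨hb'.1, hbw⟩
  rw [mem_singleton_iff] at h1 h2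
  refine Set.disjoint_left.1 hAB ha'.2 ?_
  rw [h1, ← h2]
  exact hb'.2

/-- A continuous right inverse of a polynomial is holomorphic. -/
theorem differentiableOn_of_rightInverse (hP : 2 ≤ P.natDegree) {U : Set ℂ} (hU : IsOpen U)
    {g : ℂ → ℂ} (hg : ContinuousOn g U) (hPg : ∀ w ∈ U, P.eval (g w) = w) :
    DifferentiableOn ℂ g U := by
  have hfin := finite_criticalValues hP
  have hoff : ∀ w ∈ U, w ∉ criticalValues P → DifferentiableAt ℂ g w := by
    intro w hw hwc
    have hder : P.derivative.eval (g w) ≠ 0 := fun h0 => hwc ⟨g w, h0, hPg w hw⟩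
    refine (HasDerivAt.of_local_left_inverse (hg.continuousAt (hU.mem_nhds hw))
      (P.hasDerivAt (g w)) hder ?_).differentiableAt
    filter_upwards [hU.mem_nhds hw] with y hy using hPg y hy
  intro w hw
  -- Critical values are isolated, and a continuous function has removable singularities there.
  have hV : IsOpen (U \ (criticalValues P \ {w})) := hU.sdiff (hfin.subset sdiff_subset).isClosed
  have hwV : w ∈ U \ (criticalValues P \ {w}) := ⟨hw, fun h => h.2 rfl⟩
  have h := (Complex.differentiableOn_compl_singleton_and_continuousAt_iff (hV.mem_nhds hwV)).1
    ⟨fun y hy => (hoff y hy.1.1 fun hyc => hy.1.2 ⟨hyc, hy.2⟩).differentiableWithinAt,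
      hg.continuousAt (hU.mem_nhds hw)⟩
  exact (h.differentiableAt (hV.mem_nhds hwV)).differentiableWithinAt

/-- If the polynomial has degree one over a component of a sublevel set, then each invariant
continuum inside is a repelling fixed point. -/
theorem exists_repelling_of_ncard_fiber_eq_one (hP : 2 ≤ P.natDegree) {s : ℝ} (hs : 0 < s) {c : ℂ}
    (hc : greenFunction P c < s) (hPc : P.eval c ∈ greenComponent P (P.natDegree * s) c)
    (hfib : ∀ w ∈ greenComponent P (P.natDegree * s) c \ criticalValues P,
      (greenComponent P s c ∩ (fun z => P.eval z) ⁻¹' {w}).ncard = 1)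
    {C : Set ℂ} (hC : IsCompact C) (hCc : IsConnected C) (hCD : C ⊆ greenComponent P s c)
    (hinv : (fun z => P.eval z) '' C = C) :
    ∃ z, C = {z} ∧ P.eval z = z ∧ 1 < ‖P.derivative.eval z‖ := by
  have hd : (2 : ℝ) ≤ P.natDegree := by exact_mod_cast hP
  have hst : s < P.natDegree * s := by nlinarith
  set D := greenComponent P s c with hDdef
  set D' := greenComponent P (P.natDegree * s) c with hD'def
  have hDo : IsOpen D := isOpen_greenComponent hP s c
  have hDo' : IsOpen D' := isOpen_greenComponent hP _ c
  have hmaps : MapsTo (fun z => P.eval z) D D' := mapsTo_greenComponent hP hc hPc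
  have hsurj : SurjOn (fun z => P.eval z) D D' := surjOn_greenComponent hP hc hPc
  have hinj := injOn_of_ncard_fiber_eq_one hP hDo hmaps hfib
  have hcl : closure D ⊆ D' := closure_greenComponent_subset hP hst hc
  set g : ℂ → ℂ := Function.invFunOn (fun z => P.eval z) D
  have hgD : MapsTo g D' D := hsurj.mapsTo_invFunOn
  have hPg : ∀ w ∈ D', P.eval (g w) = w := hsurj.rightInvOn_invFunOn
  have hgP : ∀ z ∈ D, g (P.eval z) = z := fun z hz =>
    hinj (hgD (hmaps hz)) hz (hPg _ (hmaps hz))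
  have hgc : ContinuousOn g D' := by
    intro w hw
    refine ContinuousAt.continuousWithinAt fun N hN => ?_
    obtain ⟨O, hON, hO, hwO⟩ := mem_nhds_iff.1 hN
    have h1 : (fun z => P.eval z) '' (D ∩ O) ∈ 𝓝 w :=
      (isOpenMap_polynomial_eval hP _ (hDo.inter hO)).mem_nhds ⟨g w, ⟨hgD hw, hwO⟩, hPg w hw⟩
    refine mem_map.2 (mem_of_superset h1 ?_)
    rintro _ ⟨z, hz, rfl⟩
    rw [mem_preimage, hgP z hz.1]
    exact hON hz.2
  have hgd := differentiableOn_of_rightInverse hP hDo' hgc hPg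
  -- The inverse branch has its values in `D`, which is relatively compact in `D'`; this is the
  -- uniform room that the contraction needs.
  obtain ⟨η, hη, hthick⟩ :=
    (isCompact_closure_greenComponent hP s c).exists_thickening_subset_open hDo' hcl
  have hgC : g '' C = C := by
    conv_lhs => rw [← hinv]
    rw [← image_comp]
    have : EqOn (g ∘ fun z => P.eval z) id C := fun z hz => hgP z (hCD hz)
    rw [this.image_eq, image_id]
  obtain ⟨z, hz, hgz, hlt⟩ := eq_singleton_of_image_eq hDo' (isBounded_greenComponent hP _ c) hgd
    hη (fun x hx => (Metric.ball_subset_thickening (subset_closure (hgD hx)) η).trans hthick)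
    hC hCc (hCD.trans (subset_closure.trans hcl)) hgC
  have hzD' : z ∈ D' := hcl (subset_closure (hCD (hz ▸ mem_singleton z)))
  have hPz : P.eval z = z := by
    have := hPg z hzD'
    rwa [hgz] at this
  refine ⟨z, hz, hPz, ?_⟩
  have h1 : HasDerivAt (fun w => P.eval (g w)) (P.derivative.eval (g z) * deriv g z) z :=
    (P.hasDerivAt (g z)).comp z (hgd.differentiableAt (hDo'.mem_nhds hzD')).hasDerivAt
  have h2 : HasDerivAt (fun w => P.eval (g w)) 1 z := by
    refine (hasDerivAt_id z).congr_of_eventuallyEq ?_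
    filter_upwards [hDo'.mem_nhds hzD'] with w hw using hPg w hw
  have h3 := congrArg norm (h1.unique h2)
  rw [hgz, norm_mul, norm_one] at h3
  by_contra! hle
  have h4 : ‖P.derivative.eval z‖ * ‖deriv g z‖ ≤ 1 * ‖deriv g z‖ := by gcongr
  linarith

/-- There is a level `s` such that all levels `s / d ^ k` avoid the critical values of `G` and the
values of `G` at the critical values of `P`. -/
theorem exists_regular_level (hP : 2 ≤ P.natDegree) :
    ∃ s : ℝ, 0 < s ∧ ∀ k : ℕ, IsGreenRegular P (s / P.natDegree ^ k) ∧
      ∀ w ∈ criticalValues P, greenFunction P w ≠ s / P.natDegree ^ k := by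
  have hd : (2 : ℝ) ≤ P.natDegree := by exact_mod_cast hP
  set bad : Set ℝ := greenFunction P '' {z | 0 < greenFunction P z ∧
    fderiv ℝ (greenFunction P) z = 0} ∪ greenFunction P '' criticalValues P with hbad
  have hbadc : bad.Countable :=
    (countable_critical_values hP).union ((finite_criticalValues hP).image _).countable
  have hall : (⋃ k : ℕ, (fun t : ℝ => t * P.natDegree ^ k) '' bad).Countable :=
    countable_iUnion fun k => hbadc.image _
  obtain ⟨s, hs, hs0⟩ := (hall.dense_compl ℝ).exists_mem_open isOpen_Ioi
    (⟨1, mem_Ioi.2 one_pos⟩ : (Ioi (0 : ℝ)).Nonempty)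
  have hspos : 0 < s := hs0
  have hnot : ∀ k : ℕ, s / P.natDegree ^ k ∉ bad := fun k hk =>
    hs (mem_iUnion.2 ⟨k, _, hk, by
      have : (0 : ℝ) < (P.natDegree : ℝ) ^ k := by positivity
      simp only
      field_simp⟩)
  refine ⟨s, hspos, fun k => ⟨fun z hz h0 => hnot k (Or.inl ⟨z, ⟨?_, h0⟩, hz⟩),
    fun w hw h => hnot k (Or.inr ⟨w, hw, h⟩)⟩⟩
  rw [hz]
  positivity

end PolynomialLike

/-! ### The polynomial-like restriction -/

theorem lemma4p2 (P : ℂ[X]) (hP : 2 ≤ P.natDegree) (C : Set ℂ)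
    (hC : IsComponentOf C (filledJuliaSet P))
    (hinv : (fun z => P.eval z) '' C = C)
    (hrep : ¬ ∃ z : ℂ, C = {z} ∧ P.eval z = z ∧ 1 < ‖P.derivative.eval z‖) :
    ∃ (D D' : Set ℂ) (m : ℕ),
      (∃ s : ℝ, 0 < s ∧ IsComponentOf D {z | greenFunction P z < s}) ∧
      (∃ s : ℝ, 0 < s ∧ IsComponentOf D' {z | greenFunction P z < s}) ∧
      IsPolynomialLike (fun z => P.eval z) D D' m ∧
      polynomialLikeFilledJuliaSet (fun z => P.eval z) D = C := by
  obtain ⟨c, hcK, rfl⟩ := hC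
  set C := connectedComponentIn (filledJuliaSet P) c with hCdef
  have hd : (2 : ℝ) ≤ P.natDegree := by exact_mod_cast hP
  have hcC : c ∈ C := mem_connectedComponentIn hcK
  have hCK : C ⊆ filledJuliaSet P := connectedComponentIn_subset _ _
  have hCconn : IsConnected C := ⟨⟨c, hcC⟩, isPreconnected_connectedComponentIn⟩
  have hG0 : ∀ z ∈ filledJuliaSet P, greenFunction P z = 0 := fun z hz =>
    (greenFunction_eq_zero_iff hP z).2 hz
  obtain ⟨s₀, hs₀, hlev⟩ := exists_regular_level hP
  set s : ℕ → ℝ := fun k => s₀ / P.natDegree ^ k with hsdef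
  have hs : ∀ k, 0 < s k := fun k => by positivity
  have hss : ∀ k, P.natDegree * s (k + 1) = s k := fun k => by
    simp only [hsdef, pow_succ]
    field_simp
  have hslt : ∀ k, s (k + 1) < s k := fun k => by nlinarith [hss k, hs (k + 1)]
  have hanti : Antitone s := antitone_nat_of_succ_le fun k => (hslt k).le
  have hslim : Tendsto s atTop (𝓝 0) :=
    tendsto_const_nhds.div_atTop (tendsto_pow_atTop_atTop_of_one_lt (by linarith))
  have hcs : ∀ k, greenFunction P c < s k := fun k => by rw [hG0 c hcK]; exact hs k
  set D : ℕ → Set ℂ := fun k => greenComponent P (s k) c with hDdef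
  have hDo : ∀ k, IsOpen (D k) := fun k => isOpen_greenComponent hP _ c
  have hDanti : Antitone D := fun i j hij => greenComponent_mono (hanti hij)
  have hCD : ∀ k, C ⊆ D k := fun k => subset_greenComponent hCconn.isPreconnected
    (fun z hz => by rw [hG0 z (hCK hz)]; exact hs k) hcC (mem_greenComponent_self (hcs k))
  have hPC : ∀ z ∈ C, P.eval z ∈ C := fun z hz => hinv ▸ mem_image_of_mem (fun z => P.eval z) hz
  have hPc : ∀ k, P.eval c ∈ greenComponent P (P.natDegree * s (k + 1)) c := fun k => by
    rw [hss]
    exact hCD k (hPC c hcC)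
  have hinter : ⋂ k, closure (D k) = C := by
    refine Subset.antisymm ?_ (subset_iInter fun k => (hCD k).trans subset_closure)
    refine (isPreconnected_iInter_of_antitone
      (fun k => isCompact_closure_greenComponent hP (s k) c)
      (fun k => (isPreconnected_greenComponent (s k) c).closure)
      fun i j hij => closure_mono (hDanti hij)).subset_connectedComponentIn
      (mem_iInter.2 fun k => subset_closure (hCD k hcC)) fun z hz => ?_
    refine (greenFunction_eq_zero_iff hP z).1 (le_antisymm ?_ (greenFunction_nonneg hP z))
    exact ge_of_tendsto' hslim fun k => le_of_mem_closure_greenComponent hP (mem_iInter.1 hz k)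
  have hCcomp : IsCompact C := by
    rw [← hinter]
    exact (isCompact_closure_greenComponent hP (s 0) c).of_isClosed_subset
      (isClosed_iInter fun _ => isClosed_closure) (iInter_subset _ 0)
  have hfin := finite_criticalValues hP
  have hbranch : ∀ k, ∃ m : ℕ,
      IsBranchedCovering (fun z => P.eval z) (closure (D (k + 1))) (closure (D k)) m ∧
      ∀ w ∈ D k \ criticalValues P, (D (k + 1) ∩ (fun z => P.eval z) ⁻¹' {w}).ncard = m := by
    intro k
    have := exists_isBranchedCovering hP (hs (k + 1)) (hlev (k + 1)).1
      (by rw [hss]; exact (hlev k).2) (hcs (k + 1)) (hPc k)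
    rwa [hss] at this
  choose m hm hfib using hbranch
  have hne : ∀ k, (D k \ criticalValues P).Nonempty := fun k =>
    nonempty_diff_finite (hDo k) ⟨c, hCD k hcC⟩ hfin
  -- Both degrees are counted over one generic point of the smaller target, and the sources are
  -- nested.
  have hmanti : Antitone m := by
    refine antitone_nat_of_succ_le fun k => ?_
    obtain ⟨w, hw, hwc⟩ := hne (k + 1)
    rw [← hfib (k + 1) w ⟨hw, hwc⟩, ← hfib k w ⟨hDanti k.le_succ hw, hwc⟩]
    exact Set.ncard_le_ncard (inter_subset_inter_left _ (hDanti (k + 1).le_succ))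
      ((finite_eval_fiber hP w).subset inter_subset_right)
  obtain ⟨N, hN⟩ : ∃ N, ∀ k, m N ≤ m k := ⟨Function.argmin m, fun k => Function.argmin_le m k⟩
  have hmN : ∀ k, N ≤ k → m k = m N := fun k hk => (hmanti hk).antisymm (hN k)
  -- An exceptional `z` comes with an open set of such points, hence with one over a generic `w`.
  -- The fibre of `w` in `D (N + 1)` would then exceed that in `D (k + 1)`, though both have `m N`
  -- points.
  have hstep : ∀ k, N ≤ k → ∀ z ∈ D (N + 1), P.eval z ∈ D k → z ∈ D (k + 1) := by
    intro k hk z hz hPz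
    by_contra hzk
    have hzs : greenFunction P z < s (k + 1) := by
      have : greenFunction P (P.eval z) < P.natDegree * s (k + 1) := by
        rw [hss]
        exact greenComponent_subset (s k) c hPz
      exact (greenFunction_eval_lt_iff hP).1 this
    have hzcl : z ∉ closure (D (k + 1)) := fun h => hzk (mem_greenComponent_of_mem_closure h hzs)
    obtain ⟨w, ⟨z', ⟨⟨hz'N, hz'k⟩, hz'w⟩, rfl⟩, hwc⟩ := nonempty_diff_finite
      (isOpenMap_polynomial_eval hP _
        (((hDo (N + 1)).inter isClosed_closure.isOpen_compl).inter
          ((hDo k).preimage P.continuous))) ⟨_, z, ⟨⟨hz, hzcl⟩, hPz⟩, rfl⟩ hfin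
    have hcard := hfib k _ ⟨hz'w, hwc⟩
    rw [hmN k hk, ← hfib N _ ⟨hDanti hk hz'w, hwc⟩] at hcard
    have heq := Set.eq_of_subset_of_ncard_le
      (inter_subset_inter_left ((fun z => P.eval z) ⁻¹' {P.eval z'})
        (hDanti (Nat.succ_le_succ hk))) hcard.ge
      ((finite_eval_fiber hP _).subset inter_subset_right)
    have : z' ∈ D (k + 1) ∩ (fun z => P.eval z) ⁻¹' {P.eval z'} := heq ▸ ⟨hz'N, rfl⟩
    exact hz'k (subset_closure this.1)
  have hm2 : 2 ≤ m N := by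
    have h0 : m N ≠ 0 := by
      obtain ⟨w, hw⟩ := hne N
      have hsurj := surjOn_greenComponent hP (hcs (N + 1)) (hPc N)
      rw [hss] at hsurj
      obtain ⟨z, hz, hzw⟩ := hsurj hw.1
      rw [← hfib N w hw]
      exact (Set.ncard_pos ((finite_eval_fiber hP w).subset inter_subset_right)).2
        ⟨z, hz, hzw⟩ |>.ne'
    have h1 : m N ≠ 1 := fun h1 => hrep
      (exists_repelling_of_ncard_fiber_eq_one hP (hs (N + 1)) (hcs (N + 1)) (hPc N)
        (by rw [hss]; exact fun w hw => (hfib N w hw).trans h1) hCcomp hCconn (hCD (N + 1)) hinv)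
    omega
  refine ⟨D (N + 1), D N, m N, ⟨s (N + 1), hs _, c, hcs _, rfl⟩, ⟨s N, hs _, c, hcs _, rfl⟩,
    ⟨isSmoothDisc_greenComponent hP (hs _) (hlev _).1 (hcs _),
      isSmoothDisc_greenComponent hP (hs _) (hlev _).1 (hcs _),
      closure_greenComponent_subset hP (hslt N) (hcs _), hm2, P.differentiable.differentiableOn,
      hm N⟩, Subset.antisymm (fun z hz => ?_) fun z hz n => ?_⟩
  · have hz : ∀ n : ℕ, (fun w => P.eval w)^[n] z ∈ closure (D (N + 1)) := hz
    have hzK : z ∈ filledJuliaSet P :=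
      (isCompact_closure_greenComponent hP (s (N + 1)) c).isBounded.subset
        (range_subset_iff.2 hz)
    have hzD : ∀ n : ℕ, (fun w => P.eval w)^[n] z ∈ D (N + 1) := fun n => by
      refine mem_greenComponent_of_mem_closure (hz n) ?_
      rw [greenFunction_iterate hP, hG0 z hzK, mul_zero]
      exact hs _
    -- Each pullback along the orbit gains one level; the induction treats all points of the orbit
    -- at once because it uses the next one.
    have hall : ∀ j n : ℕ, (fun w => P.eval w)^[n] z ∈ D (N + j + 1) := by
      intro j
      induction j with
      | zero => exact hzD
      | succ j ih =>
        intro n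
        refine hstep (N + j + 1) (by omega) _ (hzD n) ?_
        have := ih (n + 1)
        rwa [Function.iterate_succ_apply'] at this
    rw [← hinter]
    exact mem_iInter.2 fun k => subset_closure (hDanti (by omega : k ≤ N + k + 1) (hall k 0))
  · have hit : (fun w => P.eval w)^[n] z ∈ C := MapsTo.iterate hPC n hz
    exact subset_closure (hCD (N + 1) hit)
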